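/- Let $S_n$ be the set of permutations of $\{1,\dots,n\}$, written $\pi=\pi_1\cdots\pi_n$. For a sequence of distinct integers let $\mathrm{std}$ denote the permutation order isomorphic to it, and for a pattern $\tau$ let $S_n(\tau)$ be the set of all $\pi\in S_n$ no subsequence of which is order isomorphic to $\tau$. Call $i$ a descent of $\pi$ if $\pi_i>\pi_{i+1}$, a step if $\pi_i-1=\pi_{i+1}$, a right-to-left maximum if $\pi_i>\pi_j$ for all $j>i$, and a left-to-right minimum if $\pi_i<\pi_j$ for all $j<i$. Let $\mathrm{RL}(\pi)$ be the set of right-to-left maxima, and let $\mathrm{maj}(\pi)$ be the sum of the descents of $\pi$. Let $c(\pi)=(n+1-\pi_1)\cdots(n+1-\pi_n)$ and $r(\pi)=\pi_n\cdots\pi_1$. For $\sigma\in S_m$, $\alpha\in S_l$ and $1\le p\le m$, let the inflation $\sigma(\alpha,p)\in S_{m+l-1}$ be the permutation obtained from $\sigma$ by replacing the entry $\sigma_p$ by the block $\alpha_1+\sigma_p-1,\dots,\alpha_l+\sigma_p-1$ and adding $l-1$ to every entry larger than $\sigma_p$. Define $\Theta(\pi)\in S_n$ recursively, with $\Theta(\pi)=\pi$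 for $n\le 1$. For $n\ge 2$, let $b$ be the smallest index with $[b,n]\subseteq \mathrm{RL}(\pi)$, and let $a=\max(\mathrm{RL}(\pi)\setminus[b,n])$, with $a=0$ if this set is empty. 1. If $\pi$ has a step, let $k$ be the smallest step and let $\pi'\in S_{n-1}$ be the unique permutation with $\pi=\pi'(21,k)$. Then $\Theta(\pi)=\Theta(\pi')(21,k)$. 2. If $\pi$ has no step and $a=0$, let $\pi'$ be $\pi$ with the entry $n$ removed. Then $\Theta(\pi)$ is $\Theta(\pi')$ with $n$ inserted in position $b$. 3. If $\pi$ has no step and $a>0$, let $\chi=\max\{\pi_i : a<i<b\}$ and $\rho=|\{i\in \mathrm{RL}(\pi) : i>b,\ \pi_i>\chi\}|$, and set $\pi^{(1)}=\mathrm{std}(\pi_1\cdots\pi_a\,\pi_b\,\pi_{b+1}\cdots\pi_{b+\rho})$ and $\pi^{(2)}=\mathrm{std}(\pi_{a+1}\cdots\pi_b\,\pi_{b+\rho+1}\cdots\pi_n)$. Then $\Theta(\pi)=\sigma(\alpha,a+1)$, where $\sigma=\Theta(\pi^{(1)})$ and $\alpha=\Theta(\pi^{(2)})$. Put $\Omega=c\circ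 r\circ\Theta\circ r\circ c$. Then for every $n$: (i) $\Omega$ restricts to a bijection $S_n(2314)\to S_n(2413)$. (ii) For every $\pi\in S_n(2314)$, the permutations $\pi$ and $\Omega(\pi)$ have the same set of descents, the same set of left-to-right minima and the same set of steps, and the values $1$ and $2$ (those that exist) have the same positions in $\pi$ as in $\Omega(\pi)$. (iii) If $\pi\in S_n(2314)\cap S_n(2413)$, then $\Omega(\pi)=\pi$. (iv) The major index is equidistributed on $S_n(1423)$, $S_n(2413)$ and $S_n(2314)$: for every $k$, each of the three sets contains the same number of permutations with $\mathrm{maj}=k$. -/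

import Mathlib

namespace PermStat

open Finset

/-- The entry `π_i` of the one-line notation `π_1 … π_n` of a permutation, with positions and values
counted from `1`, as a natural number (and `0` when `i` is not in `[1, n]`). -/
def entry {n : ℕ} (π : Equiv.Perm (Fin n)) (i : ℕ) : ℕ :=
  if h : 1 ≤ i ∧ i ≤ n then (π ⟨i - 1, by omega⟩ : ℕ) + 1 else 0

/-- The position of the value `v` in `π`, counted from `1` (and `0` when `v` is not in `[1, n]`). -/
def position {n : ℕ} (π : Equiv.Perm (Fin n)) (v : ℕ) : ℕ := entry π⁻¹ v

/-- `π` contains the pattern with one-line notation `τ`: some subsequence of `π` is order isomorphic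
to `τ`. -/
def Contains {n m : ℕ} (π : Equiv.Perm (Fin n)) (τ : Fin m → ℕ) : Prop :=
  ∃ f : Fin m ↪o Fin n, ∀ x y, π (f x) < π (f y) ↔ τ x < τ y

/-- The set `S_n(τ)` of permutations of length `n` avoiding the pattern `τ`. -/
def avoiders (n : ℕ) {m : ℕ} (τ : Fin m → ℕ) : Set (Equiv.Perm (Fin n)) :=
  {π | ¬ Contains π τ}

/-- The set of descents: `i` with `π_i > π_{i+1}`. -/
def descents {n : ℕ} (π : Equiv.Perm (Fin n)) : Finset ℕ :=
  {i ∈ Ico 1 n | entry π (i + 1) < entry π i}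

/-- The major index. -/
def maj {n : ℕ} (π : Equiv.Perm (Fin n)) : ℕ := ∑ i ∈ descents π, i

/-- The set of (positions of) right-to-left maxima. -/
def rlMax {n : ℕ} (π : Equiv.Perm (Fin n)) : Finset ℕ :=
  {i ∈ Icc 1 n | ∀ j ∈ Ioc i n, entry π j < entry π i}

/-- The set of (positions of) left-to-right minima. -/
def lrMin {n : ℕ} (π : Equiv.Perm (Fin n)) : Finset ℕ :=
  {i ∈ Icc 1 n | ∀ j ∈ Ico (1 : ℕ) i, entry π i < entry π j}

/-- The set of steps: `i` with `π_i - 1 = π_{i+1}`. -/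
def steps {n : ℕ} (π : Equiv.Perm (Fin n)) : Finset ℕ :=
  {i ∈ Ico 1 n | entry π i = entry π (i + 1) + 1}

/-- The reverse `π_n … π_1`. -/
def reverse {n : ℕ} (π : Equiv.Perm (Fin n)) : Equiv.Perm (Fin n) := Fin.revPerm.trans π

/-- The complement `(n + 1 - π_1) … (n + 1 - π_n)`. -/
def complement {n : ℕ} (π : Equiv.Perm (Fin n)) : Equiv.Perm (Fin n) := π.trans Fin.revPerm

/-- The standardization of a word `w 1, …, w n` of distinct numbers: the permutation of length `n`
order isomorphic to it. If the word is itself a permutation of `1, …, n`, it is that permutation. -/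
def std (n : ℕ) (w : ℕ → ℕ) : Equiv.Perm (Fin n) :=
  (Tuple.sort fun i : Fin n => w (i + 1))⁻¹

theorem std_lt_std_iff {n : ℕ} {w : ℕ → ℕ}
    (hw : Function.Injective fun i : Fin n => w (i + 1)) (i j : Fin n) :
    std n w i < std n w j ↔ w (i + 1) < w (j + 1) := by
  have hm : StrictMono ((fun i : Fin n => w (i + 1)) ∘ Tuple.sort fun i : Fin n => w (i + 1)) :=
    (Tuple.monotone_sort _).strictMono_of_injective (hw.comp (Equiv.injective _))
  have h := hm.lt_iff_lt (a := std n w i) (b := std n w j)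
  simpa [std] using h.symm

/-- The word of the inflation `σ(α, p)`: the entry of `σ` at position `p` is replaced by a copy of
`α`. -/
def inflateWord {m l : ℕ} (σ : Equiv.Perm (Fin m)) (α : Equiv.Perm (Fin l)) (p : ℕ) (i : ℕ) : ℕ :=
  let hat : ℕ → ℕ := fun j =>
    if entry σ j < entry σ p then entry σ j else entry σ j + l - 1
  if i < p then hat i
  else if i < p + l then entry α (i - p + 1) + entry σ p - 1
  else hat (i - l + 1)

/-- The inflation `σ(α, p)` as a permutation of length `n`, where `n = m + l - 1`. Its word is a
permutation of `1, …, n`, so `std` only turns the word into the permutation. -/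
def inflate (n : ℕ) {m l : ℕ} (σ : Equiv.Perm (Fin m)) (α : Equiv.Perm (Fin l)) (p : ℕ) :
    Equiv.Perm (Fin n) :=
  std n (inflateWord σ α p)

/-- Delete the entry at position `p` and standardize. -/
def deleteAt {n : ℕ} (π : Equiv.Perm (Fin n)) (p : ℕ) : Equiv.Perm (Fin (n - 1)) :=
  std (n - 1) fun i => if i < p then entry π i else entry π (i + 1)

/-- Insert the value `n` at position `p` into a permutation of length `n - 1`. -/
def insertMax {n : ℕ} (π : Equiv.Perm (Fin (n - 1))) (p : ℕ) : Equiv.Perm (Fin n) :=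
  std n fun i => if i < p then entry π i else if i = p then n else entry π (i - 1)

/-- The smallest `b` with `[b, n] ⊆ RL(π)`; for `n ≥ 1` it lies in `[1, n]`, see `phiB_le`. -/
def phiB {n : ℕ} (π : Equiv.Perm (Fin n)) : ℕ :=
  Nat.find (p := fun b => 1 ≤ b ∧ Icc b n ⊆ rlMax π) ⟨n + 1, by simp⟩

/-- The largest element of `RL(π) \ [b, n]`, or `0` if this set is empty. -/
def phiA {n : ℕ} (π : Equiv.Perm (Fin n)) : ℕ := (rlMax π \ Icc (phiB π) n).sup id

/-- `χ(π) = max {π_i | a < i < b}`. -/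
def chi {n : ℕ} (π : Equiv.Perm (Fin n)) : ℕ := (Ioo (phiA π) (phiB π)).sup (entry π)

/-- `ρ(π)`: the number of right-to-left maxima `i > b` with `π_i > χ(π)`. -/
def rho {n : ℕ} (π : Equiv.Perm (Fin n)) : ℕ :=
  #{i ∈ rlMax π | phiB π < i ∧ chi π < entry π i}

/-- `π⁽¹⁾ = std(π_1 … π_a π_b … π_{b+ρ})`, of length `a + ρ + 1`. -/
def part1 {n : ℕ} (π : Equiv.Perm (Fin n)) : Equiv.Perm (Fin (phiA π + rho π + 1)) :=
  std _ fun i => if i ≤ phiA π then entry π i else entry π (i - (phiA π + 1) + phiB π)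

/-- `π⁽²⁾ = std(π_{a+1} … π_b π_{b+ρ+1} … π_n)`, of length `n - a - ρ`. -/
def part2 {n : ℕ} (π : Equiv.Perm (Fin n)) : Equiv.Perm (Fin (n - phiA π - rho π)) :=
  std _ fun i => if i + phiA π ≤ phiB π then entry π (i + phiA π)
    else entry π (i + phiA π + rho π)

theorem phiB_le {n : ℕ} (π : Equiv.Perm (Fin n)) (hn : 1 ≤ n) : phiB π ≤ n := by
  refine Nat.find_min' _ ⟨hn, fun i hi => ?_⟩
  simp only [rlMax, mem_filter, mem_Icc] at hi ⊢
  exact ⟨by omega, fun j hj => absurd (mem_Ioc.1 hj) (by omega)⟩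

theorem phiA_add_one_lt_phiB {n : ℕ} (π : Equiv.Perm (Fin n)) (ha : phiA π ≠ 0) :
    phiA π + 1 < phiB π := by
  have hb : 1 ≤ phiB π ∧ Icc (phiB π) n ⊆ rlMax π :=
    Nat.find_spec (p := fun b => 1 ≤ b ∧ Icc b n ⊆ rlMax π) _
  have hne : (rlMax π \ Icc (phiB π) n).Nonempty := by
    by_contra h
    rw [not_nonempty_iff_eq_empty] at h
    exact ha (by simp [phiA, h])
  obtain ⟨c, hc, hce⟩ := exists_mem_eq_sup _ hne (id : ℕ → ℕ)
  have hca : phiA π = c := hce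
  rw [← hca] at hc
  have hc1 : phiA π ∈ rlMax π := (mem_sdiff.1 hc).1
  have hc2 : phiA π ∉ Icc (phiB π) n := (mem_sdiff.1 hc).2
  have hc3 : phiA π ≤ n := (mem_Icc.1 (mem_filter.1 hc1).1).2
  have hlt : phiA π < phiB π := by
    by_contra h
    exact hc2 (mem_Icc.2 ⟨by omega, hc3⟩)
  by_contra hcon
  refine Nat.find_min (p := fun b => 1 ≤ b ∧ Icc b n ⊆ rlMax π) ⟨n + 1, by simp⟩ hlt
    ⟨by omega, fun i hi => ?_⟩
  rw [mem_Icc] at hi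
  by_cases hi' : i = phiA π
  · exact hi' ▸ hc1
  · exact hb.2 (mem_Icc.2 ⟨by omega, hi.2⟩)

theorem rho_le {n : ℕ} (π : Equiv.Perm (Fin n)) : rho π ≤ n - phiB π := by
  have h : ({i ∈ rlMax π | phiB π < i ∧ chi π < entry π i} : Finset ℕ) ⊆ Ioc (phiB π) n := by
    intro i hi
    simp only [rlMax, mem_filter, mem_Icc] at hi
    exact mem_Ioc.2 ⟨hi.2.1, hi.1.1.2⟩
  simpa [rho] using card_le_card h

theorem part1_length_lt {n : ℕ} (π : Equiv.Perm (Fin n)) (hn : 1 ≤ n) (ha : phiA π ≠ 0) :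
    phiA π + rho π + 1 < n := by
  have h1 := phiB_le π hn
  have h2 := phiA_add_one_lt_phiB π ha
  have h3 := rho_le π
  omega

/-- The recursively defined map `Θ`. If `π` has a step, let `k` be the smallest one; the permutation
`π'` with `π = π'(21, k)` is obtained by deleting the entry at position `k + 1`. -/
def Theta (n : ℕ) (π : Equiv.Perm (Fin n)) : Equiv.Perm (Fin n) :=
  if hn : n ≤ 1 then π
  else if hs : (steps π).Nonempty then
    let k := (steps π).min' hs
    inflate n (Theta (n - 1) (deleteAt π (k + 1))) (Equiv.swap (0 : Fin 2) 1) k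
  else if ha : phiA π = 0 then
    insertMax (Theta (n - 1) (deleteAt π (position π n))) (phiB π)
  else
    inflate n (Theta (phiA π + rho π + 1) (part1 π)) (Theta (n - phiA π - rho π) (part2 π))
      (phiA π + 1)
termination_by n
decreasing_by
  · omega
  · omega
  · exact part1_length_lt π (by omega) ha
  · omega

/-- The map `Ω = cr ∘ Θ ∘ rc`. -/
def Omega (n : ℕ) (π : Equiv.Perm (Fin n)) : Equiv.Perm (Fin n) :=
  complement (reverse (Theta n (reverse (complement π))))

/-- The number of permutations of length `n` that avoid `τ` and have major index `k`. -/
noncomputable def majCount (n : ℕ) {m : ℕ} (τ : Fin m → ℕ) (k : ℕ) : ℕ :=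
  {π ∈ avoiders n τ | maj π = k}.ncard

end PermStat

namespace PermStat

/-! Reverse-complement turns 2314 into 1423, fixes 2413, and exchanges left-to-right minima and the
values 1, 2 with right-to-left maxima and the values n, n - 1. So everything reduces to
`theta_spec`: `Theta` maps the 1423-avoiders bijectively onto the 2413-avoiders, preserves descents,
right-to-left maxima, steps and the positions of n and n - 1, and fixes the common avoiders. These
properties are proved together by strong induction on n. Words matter only up to order isomorphism,
so each recursive case is a relation between comparisons of entries.

Two cases are the same on both sides: inflating an entry by 21 (`SplitAt`) and inserting a maximum
followed by a decreasing tail (`InsertTop`). No occurrence of either pattern can use both entries of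
a step, or such a maximum, so avoidance passes through.

In the remaining case the right-to-left maxima contain `a` and all of `[b, n]`, but nothing in
between (`Shape`). In a 1423-avoider an entry at x < a smaller than one at j strictly between a and
b would give 1423 at x, a, j, b. Hence the entries at `[1, a] ∪ [b, b + r]` exceed all others, and
the word is a `Merge` of two parts sharing the entry at b. In a 2413-avoider an entry at x < a with
value between that of such a j and that of b would give 2413 at x, a, j, b. Hence some segment from
a + 1 past b is an interval of values, and collapsing the longest one shows the word as an inflation
(`Block`).

Both decompositions produce parts with the same side conditions `Parts`, phrased through preserved
statistics, so they survive applying `Theta` to the parts. The statistics of a `Merge` and of a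
`Block` depend on the parts in the same way (`Merge.sameStat`). The lengths can be recovered: the
second part has no step at its maximum, which determines r (`Merge.mid_lt_iff`), and the first has
no step at a + 1, which makes the interval longest (`Block.length_le`). If both patterns are avoided
then r = 0 and the two constructions coincide (`Shape.merge_eq_block`). -/

/-! ### Words up to order isomorphism: statistics, patterns, subwords. -/

/-- The word `w 1, …, w n` has distinct entries. -/
def WInj (n : ℕ) (w : ℕ → ℕ) : Prop :=
  ∀ i j, 1 ≤ i → i ≤ n → 1 ≤ j → j ≤ n → w i = w j → i = j

/-- Position `i` is a descent of the word `w 1, …, w n`. -/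
def IsDesc (n : ℕ) (w : ℕ → ℕ) (i : ℕ) : Prop := 1 ≤ i ∧ i < n ∧ w (i + 1) < w i

/-- Position `i` is a right-to-left maximum of the word `w 1, …, w n`. -/
def IsRL (n : ℕ) (w : ℕ → ℕ) (i : ℕ) : Prop :=
  1 ≤ i ∧ i ≤ n ∧ ∀ j, i < j → j ≤ n → w j < w i

/-- Position `i` is a step of the standardization of the word `w 1, …, w n`. -/
def IsStep (n : ℕ) (w : ℕ → ℕ) (i : ℕ) : Prop :=
  1 ≤ i ∧ i < n ∧ w (i + 1) < w i ∧ ∀ j, 1 ≤ j → j ≤ n → w j ≤ w (i + 1) ∨ w i ≤ w j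

/-- The largest entry of the word `w 1, …, w n` is at position `i`. -/
def IsTop (n : ℕ) (w : ℕ → ℕ) (i : ℕ) : Prop :=
  1 ≤ i ∧ i ≤ n ∧ ∀ j, 1 ≤ j → j ≤ n → w j ≤ w i

/-- The second largest entry of the word `w 1, …, w n` is at position `i`. -/
def IsSecond (n : ℕ) (w : ℕ → ℕ) (i : ℕ) : Prop :=
  1 ≤ i ∧ i ≤ n ∧ ∃ p, 1 ≤ p ∧ p ≤ n ∧ w i < w p ∧ ∀ j, 1 ≤ j → j ≤ n → j ≠ p → w j ≤ w i

/-- The word `w 1, …, w n` avoids `1423`. -/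
def Avoid1423 (n : ℕ) (w : ℕ → ℕ) : Prop :=
  ∀ i j k l, 1 ≤ i → i < j → j < k → k < l → l ≤ n → ¬ (w i < w k ∧ w k < w l ∧ w l < w j)

/-- The word `w 1, …, w n` avoids `2413`. -/
def Avoid2413 (n : ℕ) (w : ℕ → ℕ) : Prop :=
  ∀ i j k l, 1 ≤ i → i < j → j < k → k < l → l ≤ n → ¬ (w k < w i ∧ w i < w l ∧ w l < w j)

/-- Two words of length `n` share the statistics that are preserved by `Theta`. -/
structure SameStat (n : ℕ) (w v : ℕ → ℕ) : Prop where
  desc : ∀ i, IsDesc n w i ↔ IsDesc n v i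
  rl : ∀ i, IsRL n w i ↔ IsRL n v i
  step : ∀ i, IsStep n w i ↔ IsStep n v i
  top : ∀ i, IsTop n w i ↔ IsTop n v i
  second : ∀ i, IsSecond n w i ↔ IsSecond n v i

/-- The word `v 1, …, v m` is order isomorphic to the subsequence of `w 1, …, w n` at the positions
`f 1, …, f m`. -/
structure IsSubword (m n : ℕ) (v w f : ℕ → ℕ) : Prop where
  pos : ∀ i, 1 ≤ i → i ≤ m → 1 ≤ f i
  le : ∀ i, 1 ≤ i → i ≤ m → f i ≤ n
  mono : ∀ i j, 1 ≤ i → i < j → j ≤ m → f i < f j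
  lt_iff : ∀ i j, 1 ≤ i → i ≤ m → 1 ≤ j → j ≤ m → (v i < v j ↔ w (f i) < w (f j))

namespace IsSubword

variable {m n : ℕ} {v w f : ℕ → ℕ}

theorem avoid1423 (h : IsSubword m n v w f) (H : Avoid1423 n w) : Avoid1423 m v := by
  intro a b c d h1 h2 h3 h4 h5 h6
  refine H (f a) (f b) (f c) (f d) (h.pos _ h1 (by omega)) (h.mono _ _ h1 h2 (by omega))
    (h.mono _ _ (by omega) h3 (by omega)) (h.mono _ _ (by omega) h4 h5) (h.le _ (by omega) h5) ?_
  rwa [← h.lt_iff _ _ (by omega) (by omega) (by omega) (by omega),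
    ← h.lt_iff _ _ (by omega) (by omega) (by omega) (by omega),
    ← h.lt_iff _ _ (by omega) (by omega) (by omega) (by omega)]

theorem avoid2413 (h : IsSubword m n v w f) (H : Avoid2413 n w) : Avoid2413 m v := by
  intro a b c d h1 h2 h3 h4 h5 h6
  refine H (f a) (f b) (f c) (f d) (h.pos _ h1 (by omega)) (h.mono _ _ h1 h2 (by omega))
    (h.mono _ _ (by omega) h3 (by omega)) (h.mono _ _ (by omega) h4 h5) (h.le _ (by omega) h5) ?_
  rwa [← h.lt_iff _ _ (by omega) (by omega) (by omega) (by omega),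
    ← h.lt_iff _ _ (by omega) (by omega) (by omega) (by omega),
    ← h.lt_iff _ _ (by omega) (by omega) (by omega) (by omega)]

end IsSubword

/-! ### Inflation of one entry by 21. -/

/-- The word `w 1, …, w n` is order isomorphic to the inflation of `v 1, …, v (n - 1)` by `21` at
position `k`. -/
def SplitAt (n k : ℕ) (w v : ℕ → ℕ) : Prop :=
  ∀ i j, 1 ≤ i → i ≤ n → 1 ≤ j → j ≤ n → (w i < w j ↔
    if (i = k ∨ i = k + 1) ∧ (j = k ∨ j = k + 1) then i = k + 1 ∧ j = k
    else v (if i ≤ k then i else i - 1) < v (if j ≤ k then j else j - 1))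

namespace SplitAt

variable {n k : ℕ} {w v : ℕ → ℕ}

theorem isStep (h : SplitAt n k w v) (hk : 1 ≤ k) (hn : k < n) : IsStep n w k := by
  refine ⟨hk, hn, ?_, fun j hj hj' => ?_⟩
  · have := h (k + 1) k
    grind
  · by_contra! hc
    have h1 := h (k + 1) j
    have h2 := h j k
    grind

theorem isDesc_iff (h : SplitAt n k w v) (hk : 1 ≤ k) (hn : k < n) (i : ℕ) :
    IsDesc n w i ↔ i = k ∨ i < k ∧ IsDesc (n - 1) v i ∨ k < i ∧ IsDesc (n - 1) v (i - 1) := by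
  have := h (i + 1) i
  grind [IsDesc]

theorem isRL_iff (h : SplitAt n k w v) (hk : 1 ≤ k) (hn : k < n) (i : ℕ) :
    IsRL n w i ↔ IsRL (n - 1) v (if i ≤ k then i else i - 1) ∧ 1 ≤ i ∧ i ≤ n := by
  constructor
  · rintro ⟨h1, h2, h3⟩
    refine ⟨⟨by grind, by grind, fun j hj hj' => ?_⟩, h1, h2⟩
    have e1 := h3 (if j ≤ k then j else j + 1)
    have e2 := h (if j ≤ k then j else j + 1) i
    clear h h3
    grind
  · rintro ⟨⟨h1, h2, h3⟩, h4, h5⟩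
    refine ⟨h4, h5, fun j hj hj' => ?_⟩
    have e1 := h3 (if j ≤ k then j else j - 1)
    have e2 := h j i
    clear h h3
    grind

theorem isTop_iff (h : SplitAt n k w v) (hk : 1 ≤ k) (hn : k < n) (i : ℕ) :
    IsTop n w i ↔
      i ≠ k + 1 ∧ IsTop (n - 1) v (if i ≤ k then i else i - 1) ∧ 1 ≤ i ∧ i ≤ n := by
  constructor
  · rintro ⟨h1, h2, h3⟩
    refine ⟨?_, ⟨by grind, by grind, fun j hj hj' => ?_⟩, h1, h2⟩
    · rintro rfl
      have e1 := h3 k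
      have e2 := h (k + 1) k
      clear h h3
      grind
    have e1 := h3 (if j ≤ k then j else j + 1)
    have e2 := h i (if j ≤ k then j else j + 1)
    clear h h3
    grind
  · rintro ⟨h0, ⟨h1, h2, h3⟩, h4, h5⟩
    refine ⟨h4, h5, fun j hj hj' => ?_⟩
    have e1 := h3 (if j ≤ k then j else j - 1)
    have e2 := h i j
    clear h h3
    grind

theorem isStep_iff (h : SplitAt n k w v) (hk : 1 ≤ k) (hn : k < n) (i : ℕ) :
    IsStep n w i ↔ i = k ∨ i < k ∧ IsStep (n - 1) v i ∨ k < i ∧ IsStep (n - 1) v (i - 1) := by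
  constructor
  · rintro ⟨h1, h2, h3, h4⟩
    have e0 := h (i + 1) i
    rcases lt_trichotomy i k with hi | hi | hi
    · refine Or.inr (Or.inl ⟨hi, h1, by omega, by grind, fun j hj hj' => ?_⟩)
      have e1 := h4 (if j ≤ k then j else j + 1)
      have e2 := h (i + 1) (if j ≤ k then j else j + 1)
      have e3 := h (if j ≤ k then j else j + 1) i
      clear h h4
      grind
    · exact Or.inl hi
    · refine Or.inr (Or.inr ⟨hi, by omega, by omega, by grind, fun j hj hj' => ?_⟩)
      have e1 := h4 (if j < k then j else j + 1)
      have e2 := h (i + 1) (if j < k then j else j + 1)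
      have e3 := h (if j < k then j else j + 1) i
      clear h h4
      grind
  · have e0 := h (i + 1) i
    rintro (rfl | ⟨hi, h1, h2, h3, h4⟩ | ⟨hi, h1, h2, h3, h4⟩)
    · exact h.isStep hk hn
    · refine ⟨h1, by omega, by grind, fun j hj hj' => ?_⟩
      have e1 := h4 (if j ≤ k then j else j - 1)
      have e2 := h (i + 1) j
      have e3 := h j i
      clear h h4
      grind
    · refine ⟨by omega, by omega, by grind, fun j hj hj' => ?_⟩
      have e1 := h4 (if j ≤ k then j else j - 1)
      have e2 := h (i + 1) j
      have e3 := h j i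
      clear h h4
      grind

/-- The two copies are adjacent in value, so inflating the maximum makes its lower copy the second
largest entry; otherwise the two largest entries are inherited, an inflated second being represented
by its upper copy. -/
theorem isSecond_iff (h : SplitAt n k w v) (hk : 1 ≤ k) (hn : k < n) (i : ℕ) :
    IsSecond n w i ↔ i = k + 1 ∧ IsTop (n - 1) v k ∨ i ≠ k + 1 ∧ ¬ IsTop (n - 1) v k ∧
      IsSecond (n - 1) v (if i ≤ k then i else i - 1) ∧ 1 ≤ i ∧ i ≤ n := by
  constructor
  · rintro ⟨h1, h2, p, h3, h4, h5, h6⟩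
    by_cases hi : i = k + 1
    · refine Or.inl ⟨hi, hk, by omega, fun j hj hj' => ?_⟩
      have e1 := h6 k
      have e2 := h6 (if j ≤ k then j else j + 1)
      have e3 := h (if j ≤ k then j else j + 1) k
      have e4 := h k (if j ≤ k then j else j + 1)
      have e5 := h (k + 1) k
      clear h h6
      grind
    · refine Or.inr ⟨hi, ?_, ⟨by grind, by grind, if p ≤ k then p else p - 1, by grind, by grind,
        ?_, fun j hj hj' hj'' => ?_⟩, h1, h2⟩
      · rintro ⟨-, -, h7⟩
        have e1 := h7 (if p ≤ k then p else p - 1)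
        have e2 := h7 (if i ≤ k then i else i - 1)
        have e3 := h k p
        have e4 := h i (k + 1)
        have e5 := h6 (k + 1)
        have e6 := h i p
        have e7 := h i k
        have e8 := h6 k
        clear h h6 h7
        grind
      · have e1 := h i p
        have e2 := h6 (k + 1)
        have e3 := h6 k
        have e4 := h (k + 1) k
        clear h h6
        grind
      · have e1 := h6 (if j ≤ k then j else j + 1)
        have e2 := h i (if j ≤ k then j else j + 1)
        clear h h6
        grind
  · rintro (⟨hi, h1, h2, h3⟩ | ⟨hi, h0, ⟨h1, h2, p, h3, h4, h5, h6⟩, h7, h8⟩)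
    · refine ⟨by omega, by omega, k, hk, by omega, ?_, fun j hj hj' hj'' => ?_⟩
      · have e1 := h (k + 1) k
        grind
      · have e1 := h3 (if j ≤ k then j else j - 1)
        have e2 := h (k + 1) j
        clear h h3
        grind
    · have hp : p ≠ k := by
        rintro rfl
        refine h0 ⟨h3, h4, fun j hj hj' => ?_⟩
        have := h6 j
        grind
      refine ⟨h7, h8, if p ≤ k then p else p + 1, by grind, by grind, ?_, fun j hj hj' hj'' => ?_⟩
      · have e1 := h i (if p ≤ k then p else p + 1)
        clear h h6
        grind
      · have e1 := h6 (if j ≤ k then j else j - 1)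
        have e2 := h i j
        clear h h6
        grind

theorem sameStat {w' v' : ℕ → ℕ} (h : SplitAt n k w v) (h' : SplitAt n k w' v') (hk : 1 ≤ k)
    (hn : k < n) (hs : SameStat (n - 1) v v') : SameStat n w w' where
  desc i := by rw [h.isDesc_iff hk hn, h'.isDesc_iff hk hn, hs.desc, hs.desc]
  rl i := by rw [h.isRL_iff hk hn, h'.isRL_iff hk hn, hs.rl]
  step i := by rw [h.isStep_iff hk hn, h'.isStep_iff hk hn, hs.step, hs.step]
  top i := by rw [h.isTop_iff hk hn, h'.isTop_iff hk hn, hs.top]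
  second i := by rw [h.isSecond_iff hk hn, h'.isSecond_iff hk hn, hs.top, hs.second]

theorem isSubword (h : SplitAt n k w v) (hk : 1 ≤ k) (hn : k < n) :
    IsSubword (n - 1) n v w (fun i => if i ≤ k then i else i + 1) where
  pos i := by grind
  le i := by grind
  mono i j := by grind
  lt_iff i j h1 h2 h3 h4 := by
    have := h (if i ≤ k then i else i + 1) (if j ≤ k then j else j + 1)
    clear h
    by_cases hi : i ≤ k <;> by_cases hj : j ≤ k <;>
      simp only [hi, hj, if_true, if_false] at this ⊢ <;> grind

/-- Identifying the two copies loses only the comparison between them. -/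
theorem lt_of_lt (h : SplitAt n k w v) (i j : ℕ) (h1 : 1 ≤ i)
    (h2 : i ≤ n) (h3 : 1 ≤ j) (h4 : j ≤ n) (h5 : ¬ (j = k ∧ i = k + 1)) (hij : w i < w j) :
    v (if i ≤ k then i else i - 1) < v (if j ≤ k then j else j - 1) := by
  have := h i j h1 h2 h3 h4
  grind

/-- The pattern has no step: of its adjacent pairs only 42 descends, and the letter 3 lies between
them in value. So no occurrence uses both copies, and each one projects to `v`. The argument for
2413 is the same, with the descent 41. -/
theorem avoid1423_iff (h : SplitAt n k w v) (hk : 1 ≤ k) (hn : k < n) :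
    Avoid1423 n w ↔ Avoid1423 (n - 1) v := by
  refine ⟨(h.isSubword hk hn).avoid1423, fun H a b c d h1 h2 h3 h4 h5 ⟨h6, h7, h8⟩ => ?_⟩
  obtain ⟨-, -, s1, s2⟩ := h.isStep hk hn
  have n1 : ¬ (a = k ∧ b = k + 1) := by
    rintro ⟨rfl, rfl⟩
    omega
  have n2 : ¬ (b = k ∧ c = k + 1) := by
    rintro ⟨rfl, rfl⟩
    have := s2 d
    omega
  have n3 : ¬ (c = k ∧ d = k + 1) := by
    rintro ⟨rfl, rfl⟩
    omega
  have e1 := h.lt_of_lt a c (by omega) (by omega) (by omega) (by omega) (by omega) h6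
  have e2 := h.lt_of_lt c d (by omega) (by omega) (by omega) (by omega) (by omega) h7
  have e3 := h.lt_of_lt d b (by omega) (by omega) (by omega) (by omega) (by omega) h8
  refine H _ _ _ _ ?_ ?_ ?_ ?_ ?_ ⟨e1, e2, e3⟩ <;> split_ifs <;> omega

theorem avoid2413_iff (h : SplitAt n k w v) (hk : 1 ≤ k) (hn : k < n) :
    Avoid2413 n w ↔ Avoid2413 (n - 1) v := by
  refine ⟨(h.isSubword hk hn).avoid2413, fun H a b c d h1 h2 h3 h4 h5 ⟨h6, h7, h8⟩ => ?_⟩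
  obtain ⟨-, -, s1, s2⟩ := h.isStep hk hn
  have n1 : ¬ (a = k ∧ b = k + 1) := by
    rintro ⟨rfl, rfl⟩
    omega
  have n2 : ¬ (b = k ∧ c = k + 1) := by
    rintro ⟨rfl, rfl⟩
    have := s2 d
    omega
  have n3 : ¬ (c = k ∧ d = k + 1) := by
    rintro ⟨rfl, rfl⟩
    omega
  have e1 := h.lt_of_lt c a (by omega) (by omega) (by omega) (by omega) (by omega) h6
  have e2 := h.lt_of_lt a d (by omega) (by omega) (by omega) (by omega) (by omega) h7
  have e3 := h.lt_of_lt d b (by omega) (by omega) (by omega) (by omega) (by omega) h8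
  refine H _ _ _ _ ?_ ?_ ?_ ?_ ?_ ⟨e1, e2, e3⟩ <;> split_ifs <;> omega

end SplitAt

/-! ### Insertion of a new maximum. -/

/-- The word `w 1, …, w n` is order isomorphic to the word obtained from `v 1, …, v (n - 1)` by
inserting a new largest entry at position `b`. -/
def InsertTop (n b : ℕ) (w v : ℕ → ℕ) : Prop :=
  ∀ i j, 1 ≤ i → i ≤ n → 1 ≤ j → j ≤ n → (w i < w j ↔
    i ≠ b ∧ (j = b ∨ v (if i < b then i else i - 1) < v (if j < b then j else j - 1)))

namespace InsertTop

variable {n b : ℕ} {w v : ℕ → ℕ}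

theorem isTop_iff (h : InsertTop n b w v) (hb : 1 ≤ b) (hn : b ≤ n) (i : ℕ) :
    IsTop n w i ↔ i = b := by
  constructor
  · rintro ⟨h1, h2, h3⟩
    have e1 := h3 b
    have e2 := h i b
    clear h h3
    grind
  · rintro rfl
    refine ⟨hb, hn, fun j hj hj' => ?_⟩
    have e2 := h i j
    clear h
    grind

theorem isDesc_iff (h : InsertTop n b w v) (hb : 1 ≤ b) (hn : b ≤ n) (i : ℕ) :
    IsDesc n w i ↔ i = b ∧ b < n ∨ i + 1 < b ∧ IsDesc (n - 1) v i ∨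
      b < i ∧ IsDesc (n - 1) v (i - 1) := by
  have := h (i + 1) i
  clear h
  grind [IsDesc]

theorem isRL_iff (h : InsertTop n b w v) (hb : 1 ≤ b) (hn : b ≤ n) (i : ℕ) :
    IsRL n w i ↔ i = b ∨ b < i ∧ IsRL (n - 1) v (i - 1) := by
  constructor
  · rintro ⟨h1, h2, h3⟩
    rcases lt_trichotomy i b with hi | hi | hi
    · have e1 := h3 b
      have e2 := h b i
      clear h h3
      grind
    · exact Or.inl hi
    · refine Or.inr ⟨hi, by omega, by omega, fun j hj hj' => ?_⟩
      have e1 := h3 (j + 1)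
      have e2 := h (j + 1) i
      clear h h3
      grind
  · rintro (rfl | ⟨hi, h1, h2, h3⟩)
    · refine ⟨hb, hn, fun j hj hj' => ?_⟩
      have e2 := h j i
      clear h
      grind
    · refine ⟨by omega, by omega, fun j hj hj' => ?_⟩
      have e1 := h3 (j - 1)
      have e2 := h j i
      clear h h3
      grind

/-- The new maximum starts a step exactly when it is followed by the old maximum; this is why the
position of the maximum has to be among the preserved statistics. Inserting the maximum also
destroys any step across the insertion point. -/
theorem isStep_iff (h : InsertTop n b w v) (hb : 1 ≤ b) (hn : b ≤ n) (i : ℕ) :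
    IsStep n w i ↔ i = b ∧ IsTop (n - 1) v b ∨ i + 1 < b ∧ IsStep (n - 1) v i ∨
      b < i ∧ IsStep (n - 1) v (i - 1) := by
  constructor
  · rintro ⟨h1, h2, h3, h4⟩
    have e0 := h (i + 1) i
    rcases lt_trichotomy i b with hi | hi | hi
    · refine Or.inr (Or.inl ⟨by grind, h1, by grind, by grind, fun j hj hj' => ?_⟩)
      have e1 := h4 (if j < b then j else j + 1)
      have e2 := h (i + 1) (if j < b then j else j + 1)
      have e3 := h (if j < b then j else j + 1) i
      clear h h4
      grind
    · refine Or.inl ⟨hi, hb, by omega, fun j hj hj' => ?_⟩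
      have e1 := h4 (if j < b then j else j + 1)
      have e2 := h (i + 1) (if j < b then j else j + 1)
      have e3 := h (if j < b then j else j + 1) i
      clear h h4
      grind
    · refine Or.inr (Or.inr ⟨hi, by omega, by omega, by grind, fun j hj hj' => ?_⟩)
      have e1 := h4 (if j < b then j else j + 1)
      have e2 := h (i + 1) (if j < b then j else j + 1)
      have e3 := h (if j < b then j else j + 1) i
      clear h h4
      grind
  · have e0 := h (i + 1) i
    rintro (⟨rfl, h1, h2, h3⟩ | ⟨hi, h1, h2, h3, h4⟩ | ⟨hi, h1, h2, h3, h4⟩)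
    · refine ⟨h1, by omega, by grind, fun j hj hj' => ?_⟩
      have e1 := h3 (if j < i then j else j - 1)
      have e2 := h (i + 1) j
      have e3 := h j i
      clear h h3
      grind
    · refine ⟨h1, by omega, by grind, fun j hj hj' => ?_⟩
      have e1 := h4 (if j < b then j else j - 1)
      have e2 := h (i + 1) j
      have e3 := h j i
      clear h h4
      grind
    · refine ⟨by omega, by omega, by grind, fun j hj hj' => ?_⟩
      have e1 := h4 (if j < b then j else j - 1)
      have e2 := h (i + 1) j
      have e3 := h j i
      clear h h4
      grind

theorem isSecond_iff (h : InsertTop n b w v) (hb : 1 ≤ b) (hn : b ≤ n) (i : ℕ) :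
    IsSecond n w i ↔
      i ≠ b ∧ 1 ≤ i ∧ i ≤ n ∧ IsTop (n - 1) v (if i < b then i else i - 1) := by
  constructor
  · rintro ⟨h1, h2, p, h3, h4, h5, h6⟩
    have hpb : p = b := by
      have e1 := h6 b
      have e2 := h i b
      have e3 := h i p
      clear h h6
      grind
    subst hpb
    refine ⟨by grind, h1, h2, by grind, by grind, fun j hj hj' => ?_⟩
    have e1 := h6 (if j < p then j else j + 1)
    have e2 := h i (if j < p then j else j + 1)
    clear h h6
    grind
  · rintro ⟨hi, h1, h2, h3, h4, h5⟩
    refine ⟨h1, h2, b, hb, hn, (h i b h1 h2 hb hn).2 ⟨hi, Or.inl rfl⟩, fun j hj hj' hj'' => ?_⟩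
    have e1 := h5 (if j < b then j else j - 1)
    have e2 := h i j
    clear h h5
    grind

theorem sameStat {w' v' : ℕ → ℕ} (h : InsertTop n b w v) (h' : InsertTop n b w' v') (hb : 1 ≤ b)
    (hn : b ≤ n) (hs : SameStat (n - 1) v v') : SameStat n w w' where
  desc i := by rw [h.isDesc_iff hb hn, h'.isDesc_iff hb hn, hs.desc, hs.desc]
  rl i := by rw [h.isRL_iff hb hn, h'.isRL_iff hb hn, hs.rl]
  step i := by rw [h.isStep_iff hb hn, h'.isStep_iff hb hn, hs.step, hs.step, hs.top]
  top i := by rw [h.isTop_iff hb hn, h'.isTop_iff hb hn]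
  second i := by rw [h.isSecond_iff hb hn, h'.isSecond_iff hb hn, hs.top]

theorem isSubword (h : InsertTop n b w v) :
    IsSubword (n - 1) n v w (fun i => if i < b then i else i + 1) where
  pos i := by grind
  le i := by grind
  mono i j := by grind
  lt_iff i j h1 h2 h3 h4 := by
    have := h (if i < b then i else i + 1) (if j < b then j else j + 1)
    clear h
    by_cases hi : i < b <;> by_cases hj : j < b <;>
      simp only [hi, hj, if_true, if_false] at this ⊢ <;> grind

/-- The last two letters of the pattern ascend, so the third lies before the decreasing tail
starting at `b`. The maximum could only play the letter 4, which comes earlier still. Hence no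
occurrence uses position `b`; the same holds for 2413. -/
theorem avoid1423_iff (h : InsertTop n b w v) (hb : 1 ≤ b) (hn : b ≤ n)
    (ht : ∀ i, b ≤ i → i ≤ n → IsRL n w i) : Avoid1423 n w ↔ Avoid1423 (n - 1) v := by
  refine ⟨h.isSubword.avoid1423, fun H a e c d h1 h2 h3 h4 h5 ⟨h6, h7, h8⟩ => ?_⟩
  have hcd : ¬ b ≤ c := fun hc => by
    have := (ht c hc (by omega)).2.2 d h4 h5
    omega
  have e1 := h a c (by omega) (by omega) (by omega) (by omega)
  have e2 := h c d (by omega) (by omega) (by omega) (by omega)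
  have e3 := h d e (by omega) (by omega) (by omega) (by omega)
  have e4 : e ≠ b := fun h => by omega
  have e5 : d ≠ b := fun h => by grind
  refine H (if a < b then a else a - 1) (if e < b then e else e - 1) (if c < b then c else c - 1)
    (if d < b then d else d - 1) ?_ ?_ ?_ ?_ ?_ ⟨?_, ?_, ?_⟩ <;> grind

theorem avoid2413_iff (h : InsertTop n b w v) (hb : 1 ≤ b) (hn : b ≤ n)
    (ht : ∀ i, b ≤ i → i ≤ n → IsRL n w i) : Avoid2413 n w ↔ Avoid2413 (n - 1) v := by
  refine ⟨h.isSubword.avoid2413, fun H a e c d h1 h2 h3 h4 h5 ⟨h6, h7, h8⟩ => ?_⟩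
  have hcd : ¬ b ≤ c := fun hc => by
    have := (ht c hc (by omega)).2.2 d h4 h5
    omega
  have e1 := h c a (by omega) (by omega) (by omega) (by omega)
  have e2 := h a d (by omega) (by omega) (by omega) (by omega)
  have e3 := h d e (by omega) (by omega) (by omega) (by omega)
  have e4 : e ≠ b := fun h => by omega
  have e5 : d ≠ b := fun h => by grind
  refine H (if a < b then a else a - 1) (if e < b then e else e - 1) (if c < b then c else c - 1)
    (if d < b then d else d - 1) ?_ ?_ ?_ ?_ ?_ ⟨?_, ?_, ?_⟩ <;> grind

end InsertTop

/-! ### Merging two parts: the decomposition on the 1423 side. -/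

/-- The side conditions on the two parts of a permutation without steps that is not covered by an
insertion of its maximum: the first part, of length `m₁`, is decreasing from `a` on, with
right-to-left maxima there, and has no step except possibly at `a`; the second part, of length `m₂`,
has its maximum at `c ≥ 2`, decreases from there, and has no step. -/
structure Parts (a m₁ c m₂ : ℕ) (v₁ v₂ : ℕ → ℕ) : Prop where
  one_le : 1 ≤ a
  lt_len : a < m₁
  two_le : 2 ≤ c
  le_len : c ≤ m₂
  rl₁ : ∀ i, a ≤ i → i ≤ m₁ → IsRL m₁ v₁ i
  step₁ : ∀ i, IsStep m₁ v₁ i → i = a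
  rl₂ : ∀ i, c ≤ i → i ≤ m₂ → IsRL m₂ v₂ i
  step₂ : ∀ i, ¬ IsStep m₂ v₂ i
  top₂ : IsTop m₂ v₂ c

theorem Parts.of_sameStat {a m₁ c m₂ : ℕ} {v₁ v₂ v₁' v₂' : ℕ → ℕ} (h : Parts a m₁ c m₂ v₁ v₂)
    (h₁ : SameStat m₁ v₁ v₁') (h₂ : SameStat m₂ v₂ v₂') : Parts a m₁ c m₂ v₁' v₂' where
  one_le := h.one_le
  lt_len := h.lt_len
  two_le := h.two_le
  le_len := h.le_len
  rl₁ i hi hi' := (h₁.rl i).1 (h.rl₁ i hi hi')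
  step₁ i hi := h.step₁ i ((h₁.step i).2 hi)
  rl₂ i hi hi' := (h₂.rl i).1 (h.rl₂ i hi hi')
  step₂ i hi := h.step₂ i ((h₂.step i).2 hi)
  top₂ := (h₂.top c).1 h.top₂

/-- The shape of the set of right-to-left maxima of a word `w 1, …, w n` in the splitting case:
`[b, n]` and `a`, but nothing strictly between `a` and `b`. -/
structure Shape (n a b : ℕ) (w : ℕ → ℕ) : Prop where
  one_le : 1 ≤ a
  lt : a + 1 < b
  le : b ≤ n
  rl_left : IsRL n w a
  rl_right : ∀ i, b ≤ i → i ≤ n → IsRL n w i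
  not_rl : ∀ i, a < i → i < b → ¬ IsRL n w i

/-- An entry strictly between `a` and `b` is not a right-to-left maximum, so a larger one stands to
its right; repeating this leads into the decreasing tail, whose largest entry is at `b`. -/
theorem Shape.lt_top {n a b : ℕ} {w : ℕ → ℕ} (h : Shape n a b w) (hw : WInj n w) (j : ℕ)
    (haj : a < j) (hjn : j ≤ n) (hjb : j ≠ b) : w j < w b := by
  rcases lt_or_gt_of_ne hjb with hj | hj
  · induction hd : b - j using Nat.strong_induction_on generalizing j with
    | _ d ih =>
      have h1 := h.not_rl j haj hj
      have h2 := h.le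
      obtain ⟨k, hk, hkn, hjk⟩ : ∃ k, j < k ∧ k ≤ n ∧ w j ≤ w k := by
        by_contra! hc
        exact h1 ⟨by omega, by omega, fun k hk hk' => hc k hk hk'⟩
      have h3 : w j < w k := lt_of_le_of_ne hjk fun he =>
        absurd (hw j k (by omega) (by omega) (by omega) hkn he) (by omega)
      rcases lt_trichotomy k b with hkb | rfl | hkb
      · exact h3.trans (ih (b - k) (by omega) k (by omega) hkn (by omega) hkb rfl)
      · exact h3
      · exact h3.trans ((h.rl_right b le_rfl h.le).2.2 k hkb hkn)
  · exact (h.rl_right b le_rfl h.le).2.2 j hj hjn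

/-- The word `w 1, …, w n` is order isomorphic to the word made from `v₁ 1, …, v₁ (a + r + 1)` and
`v₂ 1, …, v₂ (n - a - r)`: the entries of `v₁` are at the positions in `[1, a] ∪ [b, b + r]`, they
are larger than all the others, and `v₂` describes the others together with the entry at `b`. -/
def Merge (n a b r : ℕ) (w v₁ v₂ : ℕ → ℕ) : Prop :=
  ∀ i j, 1 ≤ i → i ≤ n → 1 ≤ j → j ≤ n → (w i < w j ↔
    if i ≤ a ∨ b ≤ i ∧ i ≤ b + r then
      (j ≤ a ∨ b ≤ j ∧ j ≤ b + r) ∧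
        v₁ (if i ≤ a then i else i - b + a + 1) < v₁ (if j ≤ a then j else j - b + a + 1)
    else
      (j ≤ a ∨ b ≤ j ∧ j ≤ b + r) ∨
        v₂ (if i ≤ b then i - a else i - a - r) < v₂ (if j ≤ b then j - a else j - a - r))

namespace Merge

variable {n a b r : ℕ} {w v₁ v₂ : ℕ → ℕ}

theorem isRL_left (h : Merge n a b r w v₁ v₂) (hab : a + 1 < b) (hbn : b + r ≤ n) (i : ℕ)
    (hi : i ≤ a) : IsRL n w i ↔ IsRL (a + r + 1) v₁ i := by
  constructor
  · rintro ⟨h1, h2, h3⟩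
    refine ⟨h1, by omega, fun j hj hj' => ?_⟩
    have e1 := h3 (if j ≤ a then j else j - (a + 1) + b)
    have e2 := h (if j ≤ a then j else j - (a + 1) + b) i
    clear h h3
    grind
  · rintro ⟨h1, h2, h3⟩
    refine ⟨h1, by omega, fun j hj hj' => ?_⟩
    have e1 := h3 (if j ≤ a then j else j - b + a + 1)
    have e2 := h j i
    clear h h3
    grind

theorem lt_top (h : Merge n a b r w v₁ v₂) (hbn : b + r ≤ n) (i : ℕ)
    (hi : a < i) (hi' : i < b) : w i < w b := by
  have := h i b
  grind

theorem isRL_right (h : Merge n a b r w v₁ v₂) (hab : a + 1 < b) (hbn : b + r ≤ n)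
    (hp : Parts a (a + r + 1) (b - a) (n - a - r) v₁ v₂) (i : ℕ) (hi : b ≤ i) (hi' : i ≤ n) :
    IsRL n w i := by
  refine ⟨by omega, hi', fun j hj hj' => ?_⟩
  have e1 := h j i
  by_cases hr : i ≤ b + r
  · have e2 := (hp.rl₁ (i - b + a + 1) (by omega) (by omega)).2.2 (j - b + a + 1)
    clear h hp
    grind
  · have e2 := (hp.rl₂ (i - a - r) (by omega) (by omega)).2.2 (j - a - r)
    clear h hp
    grind

theorem shape (h : Merge n a b r w v₁ v₂) (hab : a + 1 < b) (hbn : b + r ≤ n)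
    (hp : Parts a (a + r + 1) (b - a) (n - a - r) v₁ v₂) : Shape n a b w where
  one_le := hp.one_le
  lt := hab
  le := by omega
  rl_left := (h.isRL_left hab hbn a le_rfl).2 (hp.rl₁ a le_rfl (by omega))
  rl_right i hi hi' := h.isRL_right hab hbn hp i hi hi'
  not_rl i hi hi' hrl := by
    have h1 := hrl.2.2 b hi' (by omega)
    have h2 := h.lt_top hbn i hi hi'
    omega

theorem isDesc_left (h : Merge n a b r w v₁ v₂) (hab : a + 1 < b) (hbn : b + r ≤ n) (i : ℕ)
    (hi : i < a) : IsDesc n w i ↔ IsDesc (a + r + 1) v₁ i := by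
  have := h (i + 1) i
  clear h
  grind [IsDesc]

theorem isDesc_mid (h : Merge n a b r w v₁ v₂) (hab : a + 1 < b) (hbn : b + r ≤ n) (i : ℕ)
    (hp : Parts a (a + r + 1) (b - a) (n - a - r) v₁ v₂)
    (hi : a < i) (hi' : i < b) : IsDesc n w i ↔ IsDesc (n - a - r) v₂ (i - a) := by
  have h1 := h (i + 1) i
  have h2 := hp.top₂.2.2 (i - a)
  have h3 : i - a + 1 = i + 1 - a := by omega
  clear h hp
  grind [IsDesc]

theorem isTop_iff (h : Merge n a b r w v₁ v₂) (hab : a + 1 < b) (hbn : b + r ≤ n)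
    (hp : Parts a (a + r + 1) (b - a) (n - a - r) v₁ v₂) (i : ℕ) :
    IsTop n w i ↔ i ≤ a ∧ IsTop (a + r + 1) v₁ i := by
  constructor
  · rintro ⟨h1, h2, h3⟩
    have hia : i ≤ a := by
      by_contra hi
      have e1 := (h.shape hab hbn hp).rl_left.2.2 i (by omega) h2
      have e2 := h3 a hp.one_le (by omega)
      omega
    refine ⟨hia, h1, by omega, fun j hj hj' => ?_⟩
    have e1 := h3 (if j ≤ a then j else j - (a + 1) + b)
    have e2 := h i (if j ≤ a then j else j - (a + 1) + b)
    clear h h3 hp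
    grind
  · rintro ⟨hia, h1, h2, h3⟩
    refine ⟨h1, by omega, fun j hj hj' => ?_⟩
    have e1 := h3 (if j ≤ a then j else j - b + a + 1)
    have e2 := h i j
    clear h h3 hp
    grind

/-- The maximum lies in the prefix because `a` is a right-to-left maximum. After `a` the largest
entry is at `b`, which is position `a + 1` of `v₁`. -/
theorem isSecond_iff (h : Merge n a b r w v₁ v₂) (hab : a + 1 < b) (hbn : b + r ≤ n)
    (hp : Parts a (a + r + 1) (b - a) (n - a - r) v₁ v₂) (i : ℕ) :
    IsSecond n w i ↔ i ≤ a ∧ IsSecond (a + r + 1) v₁ i ∨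
      i = b ∧ IsSecond (a + r + 1) v₁ (a + 1) := by
  have hs := h.shape hab hbn hp
  have hpos := hp.one_le
  constructor
  · rintro ⟨h1, h2, p, h3, h4, h5, h6⟩
    have hpa : p ≤ a := by
      by_contra hi
      have e1 := hs.rl_left.2.2 p (by omega) h4
      have e2 := h6 a hpos (by omega)
      omega
    have hib : i ≤ a ∨ i = b := by
      by_contra! hi
      have e2 := h6 b (by omega) (by omega) (by omega)
      have e3 := h i b
      have e4 := (hs.rl_right b le_rfl (by omega)).2.2 i
      clear h hp hs
      grind
    have key : IsSecond (a + r + 1) v₁ (if i ≤ a then i else a + 1) := by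
      refine ⟨by grind, by grind, p, h3, by omega, ?_, fun j hj hj' hj'' => ?_⟩
      · have e1 := h i p
        clear h h6 hp hs
        grind
      · have e1 := h6 (if j ≤ a then j else j - (a + 1) + b)
        have e2 := h i (if j ≤ a then j else j - (a + 1) + b)
        clear h h6 hp hs
        grind
    grind
  · intro hi
    obtain ⟨h1, h2, p, h3, h4, h5, h6⟩ :
        IsSecond (a + r + 1) v₁ (if i ≤ a then i else a + 1) := by grind
    have hib : i ≤ a ∨ i = b := by grind
    clear hi
    have hpa : p ≤ a := by
      by_contra hi
      have e1 := (hp.rl₁ a le_rfl (by omega)).2.2 p (by omega) h4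
      have e2 := h6 a hpos (by omega)
      omega
    refine ⟨by grind, by grind, p, h3, by omega, ?_, fun j hj hj' hj'' => ?_⟩
    · have e1 := h i p
      clear h h6 hp hs
      grind
    · have e1 := h6 (if j ≤ a then j else j - b + a + 1)
      have e2 := h i j
      clear h h6 hp hs
      grind

theorem isSubword_left (h : Merge n a b r w v₁ v₂) (hab : a + 1 < b) (hbn : b + r ≤ n) :
    IsSubword (a + r + 1) n v₁ w (fun i => if i ≤ a then i else i - (a + 1) + b) where
  pos i := by grind
  le i := by grind
  mono i j := by grind
  lt_iff i j h1 h2 h3 h4 := by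
    have := h (if i ≤ a then i else i - (a + 1) + b) (if j ≤ a then j else j - (a + 1) + b)
    clear h
    by_cases hi : i ≤ a <;> by_cases hj : j ≤ a <;>
      simp only [hi, hj, if_true, if_false] at this ⊢ <;> grind

/-- `Merge` files position `b` with the high entries. This agrees with `v₂` because `b - a` carries
its maximum, strictly so since the entries are distinct. -/
theorem isSubword_right (h : Merge n a b r w v₁ v₂) (hab : a + 1 < b) (hbn : b + r ≤ n)
    (hp : Parts a (a + r + 1) (b - a) (n - a - r) v₁ v₂) (hv : WInj (n - a - r) v₂) :
    IsSubword (n - a - r) n v₂ w (fun i => if i + a ≤ b then i + a else i + a + r) where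
  pos i := by grind
  le i := by grind
  mono i j := by grind
  lt_iff i j h1 h2 h3 h4 := by
    have e1 := h (if i + a ≤ b then i + a else i + a + r) (if j + a ≤ b then j + a else j + a + r)
    have e2 := hp.top₂.2.2 i h1 h2
    have e3 := hp.top₂.2.2 j h3 h4
    have e4 := hv i (b - a)
    have e5 := hv j (b - a)
    have r1 : i + a - a = i := by omega
    have r2 : j + a - a = j := by omega
    have r3 : i + a + r - a - r = i := by omega
    have r4 : j + a + r - a - r = j := by omega
    clear h hp hv
    by_cases hi : i + a ≤ b <;> by_cases hj : j + a ≤ b <;>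
      simp only [hi, hj, r1, r2, r3, r4, if_true, if_false] at e1 ⊢ <;> grind

/-- A step between two high or two low entries would be a step of `v₁` away from `a` or a step of
`v₂`. At `a` the value at `b` lies in between, `b - 1` is an ascent, and only `b + r` remains. -/
theorem not_isStep (h : Merge n a b r w v₁ v₂) (hab : a + 1 < b) (hbn : b + r ≤ n)
    (hp : Parts a (a + r + 1) (b - a) (n - a - r) v₁ v₂) (i : ℕ) : ¬ IsStep n w i := by
  rintro ⟨h1, h2, h3, h4⟩
  have hs := h.shape hab hbn hp
  have hpos := hp.one_le
  have e0 := h (i + 1) i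
  have left : ∀ k, k < a ∨ a < k → k + 1 ≤ a + r + 1 →
      i = (if k ≤ a then k else k - (a + 1) + b) → False := by
    intro k hk hk' hki
    refine absurd (hp.step₁ k ⟨by grind, by omega, by clear h h4 hp; grind, fun p hp1 hp2 => ?_⟩)
      (by omega)
    have e1 := h4 (if p ≤ a then p else p - (a + 1) + b)
    have e2 := h (i + 1) (if p ≤ a then p else p - (a + 1) + b)
    have e3 := h (if p ≤ a then p else p - (a + 1) + b) i
    clear h h4 hp
    by_cases hi : k ≤ a <;> by_cases hj : p ≤ a <;>
      simp only [hi, hj, if_true, if_false] at e1 e2 e3 hki ⊢ <;> grind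
  have right : ∀ k, 1 ≤ k → k < n - a - r → k + 1 ≠ b - a → k ≠ b - a →
      i = (if k + a ≤ b then k + a else k + a + r) → False := by
    intro k hk hk' hkb hkb' hki
    refine hp.step₂ k ⟨hk, hk', by clear h h4 hp; grind, fun p hp1 hp2 => ?_⟩
    have e1 := h4 (if p + a ≤ b then p + a else p + a + r)
    have e2 := h (i + 1) (if p + a ≤ b then p + a else p + a + r)
    have e3 := h (if p + a ≤ b then p + a else p + a + r) i
    have r1 : p + a - a = p := by omega
    have r3 : p + a + r - a - r = p := by omega
    have e4 := hp.top₂.2.2 k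
    have e5 := hp.top₂.2.2 (k + 1)
    have r5 : k + a - a = k := by omega
    have r6 : k + a + r - a - r = k := by omega
    have r7 : k + a + 1 - a = k + 1 := by omega
    have r8 : k + a + r + 1 - a - r = k + 1 := by omega
    clear h h4 hp
    by_cases hi : k + a ≤ b <;> by_cases hj : p + a ≤ b <;>
      simp only [hi, hj, if_true, if_false] at e1 e2 e3 hki ⊢ <;> subst hki <;>
      simp only [r1, r3, r5, r6, r7, r8] at e2 e3 <;> grind
  rcases lt_trichotomy i a with hi | hi | hi
  · exact left i (by omega) (by omega) (by grind)
  · subst hi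
    have e1 := h4 b
    have e2 := hs.rl_left.2.2 b
    have e3 := h.lt_top hbn (i + 1)
    grind
  rcases lt_trichotomy (i + 1) b with hi' | hi' | hi'
  · exact right (i - a) (by omega) (by omega) (by omega) (by omega) (by grind)
  · have e3 := h.lt_top hbn i
    grind
  rcases lt_trichotomy i (b + r) with hi'' | hi'' | hi''
  · exact left (i - b + (a + 1)) (by omega) (by omega) (by grind)
  -- From the high tail to the low tail: a step here makes the next entry the largest low one, hence
  -- a step of `v₂` at its maximum.
  · refine hp.step₂ (b - a) ⟨by omega, by omega, (hp.rl₂ (b - a) le_rfl (by omega)).2.2 _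
      (by omega) (by omega), fun p hp1 hp2 => ?_⟩
    have e1 := h4 (if p + a ≤ b then p + a else p + a + r)
    have e2 := h (i + 1) (if p + a ≤ b then p + a else p + a + r)
    have e3 := h (if p + a ≤ b then p + a else p + a + r) i
    have r1 : p + a - a = p := by omega
    have r3 : p + a + r - a - r = p := by omega
    clear h h4 hp
    by_cases hj : p + a ≤ b <;> simp only [hj, r1, r3, if_true, if_false] at e1 e2 e3 ⊢ <;> grind
  · exact right (i - a - r) (by omega) (by omega) (by omega) (by omega) (by grind)

/-- This recovers `r` from the word. If a later tail entry exceeded the whole middle, so would the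
one at `b + r + 1`, and `v₂` would have a step at its maximum. -/
theorem mid_lt_iff (h : Merge n a b r w v₁ v₂) (hab : a + 1 < b) (hbn : b + r ≤ n)
    (hp : Parts a (a + r + 1) (b - a) (n - a - r) v₁ v₂) (i : ℕ) (hi : b < i) (hi' : i ≤ n) :
    (∀ j, a < j → j < b → w j < w i) ↔ i ≤ b + r := by
  constructor
  · intro H
    by_contra hc
    refine hp.step₂ (b - a) ⟨by omega, by omega, (hp.rl₂ (b - a) le_rfl (by omega)).2.2 _
      (by omega) (by omega), fun p hp1 hp2 => ?_⟩
    rcases lt_trichotomy p (b - a) with hpb | hpb | hpb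
    · have e1 := H (p + a)
      have e2 := h (p + a) i
      have e3 := (hp.rl₂ (b - a + 1) (by omega) (by omega)).2.2 (i - a - r)
      have r1 : p + a - a = p := by omega
      clear h H hp
      grind
    · subst hpb
      exact Or.inr le_rfl
    · rcases Nat.lt_or_ge (b - a + 1) p with hpb' | hpb'
      · exact Or.inl ((hp.rl₂ (b - a + 1) (by omega) (by omega)).2.2 p hpb' hp2).le
      · exact Or.inl (by rw [show p = b - a + 1 by omega])
  · intro hir j hj hj'
    have := h j i
    grind

/-- The letters 2 and 3 ascend, so the 2 stands before `b`. If it is in the prefix, the 3 is high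
and the occurrence lies in `v₁`. If it is in the middle, the smaller 1 is low, so the 4 is in the
middle as well and the 3 below it is low: the occurrence lies in `v₂`. -/
theorem avoid1423 (h : Merge n a b r w v₁ v₂) (hab : a + 1 < b) (hbn : b + r ≤ n)
    (hp : Parts a (a + r + 1) (b - a) (n - a - r) v₁ v₂) (h₁ : Avoid1423 (a + r + 1) v₁)
    (h₂ : Avoid1423 (n - a - r) v₂) : Avoid1423 n w := by
  intro i j k l h1 h2 h3 h4 h5 ⟨h6, h7, h8⟩
  have hkl : ¬ b ≤ k := fun hc => by
    have := (h.isRL_right hab hbn hp k hc (by omega)).2.2 l h4 h5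
    omega
  have e1 := h i k
  have e2 := h k l
  have e3 := h l j
  clear h hp
  by_cases hk : k ≤ a
  · refine h₁ i j k (if l ≤ a then l else l - b + a + 1) h1 h2 h3 ?_ ?_ ⟨?_, ?_, ?_⟩ <;>
      clear h₁ h₂ <;> grind
  · refine h₂ (i - a) (j - a) (k - a) (if l ≤ b then l - a else l - a - r) ?_ ?_ ?_ ?_ ?_
      ⟨?_, ?_, ?_⟩ <;> clear h₁ h₂ <;> grind

end Merge

/-! ### Every 1423-avoider of the given shape is a merge. -/

section Decomposition

variable {n a b r : ℕ} {w v₁ v₂ : ℕ → ℕ}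

/-- Otherwise `x`, `a`, `j`, `b` form 1423. -/
theorem Shape.prefix_gt (h : Shape n a b w) (hw : WInj n w) (H : Avoid1423 n w) (x j : ℕ)
    (hx : 1 ≤ x) (hxa : x ≤ a) (hj : a < j) (hjb : j < b) : w j < w x := by
  have hbn := h.le
  rcases eq_or_lt_of_le hxa with rfl | hxa
  · exact h.rl_left.2.2 j hj (by omega)
  by_contra hc
  refine H x a j b hx hxa hj hjb hbn ⟨lt_of_le_of_ne (by omega) fun he => ?_,
    h.lt_top hw j hj (by omega) (by omega), h.rl_left.2.2 b (by omega) hbn⟩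
  have := hw x j hx (by omega) (by omega) (by omega) he
  omega

/-- Middle entries lie below the prefix by `Shape.prefix_gt` and below the high tail by the choice
of `r`. An entry after `b + r` is at most some middle entry, and the tail decreases. -/
theorem Shape.low_lt_high (h : Shape n a b w) (hw : WInj n w) (H : Avoid1423 n w)
    (hr : ∀ i, b < i → i ≤ n → ((∀ j, a < j → j < b → w j < w i) ↔ i ≤ b + r)) (i j : ℕ)
    (hi : 1 ≤ i) (hin : i ≤ n) (hi' : i ≤ a ∨ b ≤ i ∧ i ≤ b + r) (hj : a < j) (hjn : j ≤ n)
    (hj' : j < b ∨ b + r < j) : w j < w i := by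
  rcases hj' with hj' | hj'
  · rcases hi' with hi' | ⟨h1, h2⟩
    · exact h.prefix_gt hw H i j hi hi' hj hj'
    · rcases eq_or_lt_of_le h1 with rfl | h1
      · exact h.lt_top hw j hj hjn (by omega)
      · exact (hr i h1 hin).2 h2 j hj hj'
  · have hnot := mt (hr j (by omega) hjn).1 (by omega)
    push Not at hnot
    obtain ⟨k, hk, hkb, hjk⟩ := hnot
    rcases hi' with hi' | ⟨h1, h2⟩
    · exact hjk.trans_lt (h.prefix_gt hw H i k hi hi' hk hkb)
    · exact (h.rl_right i h1 hin).2.2 j (by omega) hjn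

theorem Shape.merge (h : Shape n a b w) (hw : WInj n w) (H : Avoid1423 n w)
    (hbr : b + r ≤ n)
    (hr : ∀ i, b < i → i ≤ n → ((∀ j, a < j → j < b → w j < w i) ↔ i ≤ b + r))
    (h₁ : IsSubword (a + r + 1) n v₁ w (fun i => if i ≤ a then i else i - (a + 1) + b))
    (h₂ : IsSubword (n - a - r) n v₂ w (fun i => if i + a ≤ b then i + a else i + a + r)) :
    Merge n a b r w v₁ v₂ := by
  intro i j hi hin hj hjn
  have hab := h.lt
  have e1 := h₁.lt_iff (if i ≤ a then i else i - b + a + 1) (if j ≤ a then j else j - b + a + 1)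
  have e2 := h₂.lt_iff (if i ≤ b then i - a else i - a - r) (if j ≤ b then j - a else j - a - r)
  have e3 := h.low_lt_high hw H hr i j
  have e4 := h.low_lt_high hw H hr j i
  clear h hw H hr h₁ h₂
  by_cases hi1 : i ≤ a ∨ b ≤ i ∧ i ≤ b + r <;> by_cases hj1 : j ≤ a ∨ b ≤ j ∧ j ≤ b + r <;>
    simp only [hi1, hj1, if_true, if_false, true_and, false_and, true_or, false_or, iff_true,
      iff_false]
  · rw [e1 (by grind) (by grind) (by grind) (by grind)]
    clear e1 e2 e3 e4
    rw [show (if (if i ≤ a then i else i - b + a + 1) ≤ a then if i ≤ a then i else i - b + a + 1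
        else (if i ≤ a then i else i - b + a + 1) - (a + 1) + b) = i by grind,
      show (if (if j ≤ a then j else j - b + a + 1) ≤ a then if j ≤ a then j else j - b + a + 1
        else (if j ≤ a then j else j - b + a + 1) - (a + 1) + b) = j by grind]
  · clear e1 e2
    grind
  · clear e1 e2
    grind
  · rw [e2 (by grind) (by grind) (by grind) (by grind)]
    clear e1 e2 e3 e4
    rw [show (if (if i ≤ b then i - a else i - a - r) + a ≤ b then
        (if i ≤ b then i - a else i - a - r) + a
        else (if i ≤ b then i - a else i - a - r) + a + r) = i by grind,
      show (if (if j ≤ b then j - a else j - a - r) + a ≤ b then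
        (if j ≤ b then j - a else j - a - r) + a
        else (if j ≤ b then j - a else j - a - r) + a + r) = j by grind]

/-- Adjacent positions of a part are adjacent in `w`, except at `a` in `v₁` and at the maximum of
`v₂`. Elsewhere a step of a part would be a step of `w`, as the entries of the other part are all on
one side. At the maximum of `v₂` the choice of `r` excludes a step. -/
theorem Shape.parts (h : Shape n a b w) (hw : WInj n w) (H : Avoid1423 n w)
    (hs : ∀ i, ¬ IsStep n w i) (hbr : b + r ≤ n)
    (hr : ∀ i, b < i → i ≤ n → ((∀ j, a < j → j < b → w j < w i) ↔ i ≤ b + r))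
    (h₁ : IsSubword (a + r + 1) n v₁ w (fun i => if i ≤ a then i else i - (a + 1) + b))
    (h₂ : IsSubword (n - a - r) n v₂ w (fun i => if i + a ≤ b then i + a else i + a + r)) :
    Parts a (a + r + 1) (b - a) (n - a - r) v₁ v₂ := by
  have hab := h.lt
  have hpos := h.one_le
  have low := h.low_lt_high hw H hr
  refine ⟨h.one_le, by omega, by omega, by omega,
    fun i hi hi' => ⟨by omega, hi', fun j hj hj' => ?_⟩,
    fun i ⟨h1, h2, h3, h4⟩ => ?_, fun i hi hi' => ⟨by omega, hi', fun j hj hj' => ?_⟩,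
    fun i ⟨h1, h2, h3, h4⟩ => ?_, by omega, by omega, fun j hj hj' => ?_⟩
  · have e1 := h₁.lt_iff j i
    have e2 := h.rl_left.2.2 (j - (a + 1) + b)
    have e3 := (h.rl_right (i - (a + 1) + b))
    have e4 : a + 1 ≤ i → b ≤ i - (a + 1) + b → i - (a + 1) + b ≤ n → j - (a + 1) + b ≤ n →
      w (j - (a + 1) + b) < w (i - (a + 1) + b) := fun h0 h1 h2 => (e3 h1 h2).2.2 _ (by omega)
    clear h hw H hr h₁ h₂ low e3
    grind
  · by_contra hia
    refine hs (if i ≤ a then i else i - (a + 1) + b) ⟨by grind, by grind, ?_, fun p hp hp' => ?_⟩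
    · have e1 := h₁.lt_iff (i + 1) i
      clear h hw H hr h₁ h₂ low hs
      grind
    · by_cases hp1 : p ≤ a ∨ b ≤ p ∧ p ≤ b + r
      · have e1 := h4 (if p ≤ a then p else p - b + a + 1)
        have e2 := h₁.lt_iff (i + 1) (if p ≤ a then p else p - b + a + 1)
        have e3 := h₁.lt_iff (if p ≤ a then p else p - b + a + 1) i
        clear h hw H hr h₁ h₂ low hs
        have e5 : (if (if p ≤ a then p else p - b + a + 1) ≤ a then
            if p ≤ a then p else p - b + a + 1
            else (if p ≤ a then p else p - b + a + 1) - (a + 1) + b) = p := by grind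
        simp only [e5] at e2 e3
        have e6 : (if i + 1 ≤ a then i + 1 else i + 1 - (a + 1) + b) =
            (if i ≤ a then i else i - (a + 1) + b) + 1 := by grind
        rw [e6] at e2
        have e7 : 1 ≤ (if p ≤ a then p else p - b + a + 1) := by grind
        have e8 : (if p ≤ a then p else p - b + a + 1) ≤ a + r + 1 := by grind
        have e9 := e1 e7 e8
        have e10 := e2 (by omega) (by omega) e7 e8
        have e11 := e3 e7 e8 (by omega) (by omega)
        omega
      · left
        refine (low _ p ?_ ?_ ?_ (by omega) hp' (by omega)).le <;> grind
  · have e1 := h₂.lt_iff j i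
    have e4 : b ≤ i + a + r → i + a + r ≤ n → j + a + r ≤ n →
      w (j + a + r) < w (i + a + r) := fun h1 h2 => (h.rl_right _ h1 h2).2.2 _ (by omega)
    have e5 := (h.rl_right b le_rfl h.le).2.2 (j + a + r)
    have e6 : i + a = b ∨ b < i + a := by omega
    clear h hw H hr h₁ h₂ low
    grind
  · have e0 := h₂.lt_iff (i + 1) i
    have far : i + 1 < b - a ∨ b - a < i → False := by
      intro hib
      have g0 : (if i + 1 + a ≤ b then i + 1 + a else i + 1 + a + r) =
        (if i + a ≤ b then i + a else i + a + r) + 1 := by grind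
      rw [g0] at e0
      refine hs (if i + a ≤ b then i + a else i + a + r) ⟨by grind, by grind,
        (e0 (by omega) (by omega) h1 (by omega)).1 h3, fun p hp hp' => ?_⟩
      by_cases hp1 : p ≤ a ∨ b ≤ p ∧ p ≤ b + r
      · right
        refine (low p _ hp hp' hp1 ?_ ?_ ?_).le <;> grind
      · have e1 := h4 (if p ≤ b then p - a else p - a - r) (by grind) (by grind)
        have e2 := h₂.lt_iff (i + 1) (if p ≤ b then p - a else p - a - r) (by grind) (by grind)
          (by grind) (by grind)
        have e3 := h₂.lt_iff (if p ≤ b then p - a else p - a - r) i (by grind) (by grind)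
          (by grind) (by grind)
        have e5 : (if (if p ≤ b then p - a else p - a - r) + a ≤ b then
          (if p ≤ b then p - a else p - a - r) + a
          else (if p ≤ b then p - a else p - a - r) + a + r) = p := by grind
        simp only [e5, g0] at e2 e3
        omega
    rcases lt_trichotomy i (b - a) with hi | hi | hi
    · rcases eq_or_ne (i + 1) (b - a) with he | he
      · have e1 := h.lt_top hw (i + a) (by omega) (by omega) (by omega)
        have e2 := (e0 (by omega) (by omega) h1 (by omega)).1 h3
        grind
      · exact far (by omega)
    -- The entry at `b + r + 1` fails the threshold, so some middle entry separates it in value from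
    -- the one at `b`.
    · have hnot := mt (hr (b + r + 1) (by omega) (by omega)).1 (by omega)
      push Not at hnot
      obtain ⟨k, hk, hkb, hjk⟩ := hnot
      have e1 := h4 (k - a) (by omega) (by omega)
      have e2 := h₂.lt_iff (i + 1) (k - a) (by omega) (by omega) (by omega) (by omega)
      have e3 := h₂.lt_iff (k - a) i (by omega) (by omega) (by omega) (by omega)
      have e4 := h.lt_top hw k hk (by omega) (by omega)
      have e5 : w k ≠ w (b + r + 1) := fun he => by
        have := hw _ _ (by omega) (by omega) (by omega) (by omega) he
        omega
      have r1 : i + 1 + a + r = b + r + 1 := by omega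
      have r2 : k - a + a = k := by omega
      have r3 : i + a = b := by omega
      simp only [r1, r2, r3] at e2 e3
      clear h hw H hr h₁ h₂ low far
      grind
    · exact far (by omega)
  · rcases eq_or_ne j (b - a) with rfl | hne
    · rfl
    · have e1 := h₂.lt_iff j (b - a)
      have e2 := h.lt_top hw (if j + a ≤ b then j + a else j + a + r)
      clear h hw H hr h₁ h₂ low
      grind

end Decomposition

/-! ### Inflation by a block: the decomposition on the 2413 side. -/

/-- The word `w 1, …, w n` is order isomorphic to the inflation of `s 1, …, s (n - l + 1)` at
position `a + 1` by `t 1, …, t l`. -/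
def Block (n a l : ℕ) (w s t : ℕ → ℕ) : Prop :=
  ∀ i j, 1 ≤ i → i ≤ n → 1 ≤ j → j ≤ n → (w i < w j ↔
    if (a < i ∧ i ≤ a + l) ∧ (a < j ∧ j ≤ a + l) then t (i - a) < t (j - a)
    else s (if i ≤ a then i else if i ≤ a + l then a + 1 else i - l + 1) <
      s (if j ≤ a then j else if j ≤ a + l then a + 1 else j - l + 1))

namespace Block

variable {n a b l : ℕ} {w s t : ℕ → ℕ}

/-- Any entry of the block may represent position `a + 1` of `s`; the comparison only requires that
not both entries are in the block. -/
theorem lt_of_left (h : Block n a l w s t) (hl : 1 ≤ l) (hn : a + l ≤ n) (i j k p : ℕ) (hi : 1 ≤ i)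
    (hin : i ≤ n - l + 1) (hj : 1 ≤ j) (hjn : j ≤ n - l + 1) (hij : i ≠ j)
    (hk : i ≤ a ∧ k = i ∨ i = a + 1 ∧ a < k ∧ k ≤ a + l ∨ a + 1 < i ∧ k = i + l - 1)
    (hp : j ≤ a ∧ p = j ∨ j = a + 1 ∧ a < p ∧ p ≤ a + l ∨ a + 1 < j ∧ p = j + l - 1) :
    s i < s j ↔ w k < w p := by
  have := h k p
  clear h
  grind

theorem lt_of_right (h : Block n a l w s t) (hn : a + l ≤ n) (i j : ℕ) (hi : 1 ≤ i)
    (hil : i ≤ l) (hj : 1 ≤ j) (hjl : j ≤ l) : t i < t j ↔ w (i + a) < w (j + a) := by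
  have := h (i + a) (j + a)
  have r1 : i + a - a = i := by omega
  have r2 : j + a - a = j := by omega
  simp only [r1, r2] at this
  clear h
  grind

theorem isRL_left (h : Block n a l w s t) (hl : 1 ≤ l) (hn : a + l ≤ n) (i : ℕ)
    (hi : i ≤ a) : IsRL n w i ↔ IsRL (n - l + 1) s i := by
  constructor
  · rintro ⟨h1, h2, h3⟩
    refine ⟨h1, by omega, fun j hj hj' => ?_⟩
    have e1 := h3 (if j ≤ a then j else j + l - 1)
    have e2 := h (if j ≤ a then j else j + l - 1) i
    clear h h3
    grind
  · rintro ⟨h1, h2, h3⟩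
    refine ⟨h1, by omega, fun j hj hj' => ?_⟩
    have e1 := h3 (if j ≤ a then j else if j ≤ a + l then a + 1 else j - l + 1)
    have e2 := h j i
    clear h h3
    grind

theorem lt_top (h : Block n a l w s t) (hab : a + 1 < b) (hbl : b ≤ a + l) (hn : a + l ≤ n)
    (hp : Parts a (n - l + 1) (b - a) l s t) (ht : WInj l t) (i : ℕ)
    (hi : a < i) (hi' : i < b) : w i < w b := by
  have e1 := h i b
  have e2 := hp.top₂.2.2 (i - a)
  have e3 := ht (i - a) (b - a)
  clear h hp ht
  grind

theorem isRL_right (h : Block n a l w s t) (hab : a + 1 < b) (hn : a + l ≤ n)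
    (hp : Parts a (n - l + 1) (b - a) l s t) (i : ℕ) (hi : b ≤ i) (hi' : i ≤ n) :
    IsRL n w i := by
  refine ⟨by omega, hi', fun j hj hj' => ?_⟩
  have e1 := h j i
  by_cases hr : j ≤ a + l
  · have e2 := (hp.rl₂ (i - a) (by omega) (by omega)).2.2 (j - a)
    clear h hp
    grind
  · have e2 := (hp.rl₁ (if i ≤ a + l then a + 1 else i - l + 1) (by grind) (by grind)).2.2
      (j - l + 1)
    clear h hp
    grind

theorem shape (h : Block n a l w s t) (hab : a + 1 < b) (hbl : b ≤ a + l) (hn : a + l ≤ n)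
    (hp : Parts a (n - l + 1) (b - a) l s t) (ht : WInj l t) : Shape n a b w where
  one_le := hp.one_le
  lt := hab
  le := by omega
  rl_left := (h.isRL_left (by omega) hn a le_rfl).2 (hp.rl₁ a le_rfl (by omega))
  rl_right i hi hi' := h.isRL_right hab hn hp i hi hi'
  not_rl i hi hi' hrl := by
    have h1 := hrl.2.2 b hi' (by omega)
    have h2 := h.lt_top hab hbl hn hp ht i hi hi'
    omega

theorem isDesc_left (h : Block n a l w s t) (hl : 1 ≤ l) (hn : a + l ≤ n) (i : ℕ)
    (hi : i < a) : IsDesc n w i ↔ IsDesc (n - l + 1) s i := by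
  have := h (i + 1) i
  clear h
  grind [IsDesc]

theorem isDesc_mid (h : Block n a l w s t) (hbl : b ≤ a + l) (hn : a + l ≤ n) (i : ℕ)
    (hi : a < i) (hi' : i < b) : IsDesc n w i ↔ IsDesc l t (i - a) := by
  have h1 := h (i + 1) i
  have h3 : i - a + 1 = i + 1 - a := by omega
  clear h
  grind [IsDesc]

theorem isTop_iff (h : Block n a l w s t) (hab : a + 1 < b) (hbl : b ≤ a + l) (hn : a + l ≤ n)
    (hp : Parts a (n - l + 1) (b - a) l s t) (ht : WInj l t) (i : ℕ) :
    IsTop n w i ↔ i ≤ a ∧ IsTop (n - l + 1) s i := by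
  have hs := h.shape hab hbl hn hp ht
  have hpos := hp.one_le
  constructor
  · rintro ⟨h1, h2, h3⟩
    have hia : i ≤ a := by
      by_contra hi
      have e1 := hs.rl_left.2.2 i (by omega) h2
      have e2 := h3 a hp.one_le (by omega)
      omega
    refine ⟨hia, h1, by omega, fun j hj hj' => ?_⟩
    have e1 := h3 (if j ≤ a then j else j + l - 1)
    have e2 := h i (if j ≤ a then j else j + l - 1)
    clear h h3 hp ht hs
    grind
  · rintro ⟨hia, h1, h2, h3⟩
    refine ⟨h1, by omega, fun j hj hj' => ?_⟩
    have e1 := h3 (if j ≤ a then j else if j ≤ a + l then a + 1 else j - l + 1)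
    have e2 := h i j
    clear h h3 hp ht hs
    grind

theorem isSecond_iff (h : Block n a l w s t) (hab : a + 1 < b) (hbl : b ≤ a + l) (hn : a + l ≤ n)
    (hp : Parts a (n - l + 1) (b - a) l s t) (ht : WInj l t) (i : ℕ) :
    IsSecond n w i ↔ i ≤ a ∧ IsSecond (n - l + 1) s i ∨
      i = b ∧ IsSecond (n - l + 1) s (a + 1) := by
  have hs := h.shape hab hbl hn hp ht
  have hpos := hp.one_le
  constructor
  · rintro ⟨h1, h2, p, h3, h4, h5, h6⟩
    have hpa : p ≤ a := by
      by_contra hi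
      have e1 := hs.rl_left.2.2 p (by omega) h4
      have e2 := h6 a hpos (by omega)
      omega
    have hib : i ≤ a ∨ i = b := by
      by_contra! hi
      have e2 := h6 b (by omega) (by omega) (by omega)
      have e3 := h.lt_top hab hbl hn hp ht i
      have e4 := (hs.rl_right b le_rfl (by omega)).2.2 i
      clear h hp hs ht
      grind
    have key : IsSecond (n - l + 1) s (if i ≤ a then i else a + 1) := by
      refine ⟨by grind, by grind, p, h3, by omega, ?_, fun j hj hj' hj'' => ?_⟩
      · have e1 := h i p
        clear h h6 hp hs ht
        grind
      · have e1 := h6 (if j ≤ a then j else j + l - 1)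
        have e2 := h i (if j ≤ a then j else j + l - 1)
        clear h h6 hp hs ht
        grind
    grind
  · intro hi
    obtain ⟨h1, h2, p, h3, h4, h5, h6⟩ :
        IsSecond (n - l + 1) s (if i ≤ a then i else a + 1) := by grind
    have hib : i ≤ a ∨ i = b := by grind
    clear hi
    have hpa : p ≤ a := by
      by_contra hi
      have e1 := (hp.rl₁ a le_rfl (by omega)).2.2 p (by omega) h4
      have e2 := h6 a hpos (by omega)
      omega
    refine ⟨by grind, by grind, p, h3, by omega, ?_, fun j hj hj' hj'' => ?_⟩
    · have e1 := h i p
      clear h h6 hp hs ht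
      grind
    · have e1 := h6 (if j ≤ a then j else if j ≤ a + l then a + 1 else j - l + 1)
      have e2 := h i j
      have e3 := h.lt_top hab hbl hn hp ht j
      have e4 := (hs.rl_right b le_rfl (by omega)).2.2 j
      clear h h6 hp hs ht
      grind

/-- A step inside the block is a step of `t`; one outside or leaving the block on the right is a
step of `s` away from `a`. At `a` the value at `b` lies in between. -/
theorem not_isStep (h : Block n a l w s t) (hab : a + 1 < b) (hbl : b ≤ a + l) (hn : a + l ≤ n)
    (hp : Parts a (n - l + 1) (b - a) l s t) (ht : WInj l t) (i : ℕ) : ¬ IsStep n w i := by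
  rintro ⟨h1, h2, h3, h4⟩
  have hs := h.shape hab hbl hn hp ht
  have hpos := hp.one_le
  rcases eq_or_ne i a with rfl | hia
  · have e1 := h4 b
    have e2 := hs.rl_left.2.2 b
    have e3 := h.lt_top hab hbl hn hp ht (i + 1)
    grind
  have e0 := h (i + 1) i
  by_cases hm : a < i ∧ i < a + l
  · refine hp.step₂ (i - a) ⟨by omega, by omega, ?_, fun p hp1 hp2 => ?_⟩
    · rw [show i - a + 1 = i + 1 - a by omega]
      clear h
      grind
    · have e1 := h4 (p + a)
      have e2 := h (i + 1) (p + a)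
      have e3 := h (p + a) i
      have r1 : i - a + 1 = i + 1 - a := by omega
      have r2 : p + a - a = p := by omega
      clear h h4 hp
      grind
  · refine absurd (hp.step₁ (if i ≤ a then i else i - l + 1)
      ⟨by grind, by grind, ?_, fun p hp1 hp2 => ?_⟩) (by grind)
    · clear h
      grind
    · have e1 := h4 (if p ≤ a then p else p + l - 1)
      have e2 := h (i + 1) (if p ≤ a then p else p + l - 1)
      have e3 := h (if p ≤ a then p else p + l - 1) i
      clear h h4 hp
      by_cases hj : p ≤ a <;> simp only [hj, if_true, if_false] at e1 e2 e3 <;>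
      by_cases hi : i ≤ a <;> simp only [hi, if_true, if_false] at e2 e3 ⊢ <;> grind

/-- The pattern 2413 is simple: no two or three of its letters form an interval in both position and
value. So an occurrence lies inside the block or meets it at most once, giving an occurrence in `t`
or in `s`. -/
theorem avoid2413 (h : Block n a l w s t) (hn : a + l ≤ n) (hs : Avoid2413 (n - l + 1) s)
    (ht : Avoid2413 l t) : Avoid2413 n w := by
  intro i j k p h1 h2 h3 h4 h5 ⟨h6, h7, h8⟩
  -- The block is convex in value.
  have conv : ∀ x y z, 1 ≤ x → x ≤ n → 1 ≤ z → z ≤ n → (a < x ∧ x ≤ a + l) →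
      (a < z ∧ z ≤ a + l) → 1 ≤ y → y ≤ n → w x < w y → w y < w z → (a < y ∧ y ≤ a + l) := by
    intro x y z hx hx' hz hz' hxl hzl hy hy' h1 h2
    have e1 := h x y
    have e2 := h y z
    clear h
    grind
  have e1 := h k i
  have e2 := h i p
  have e3 := h p j
  by_cases hij : (a < i ∧ i ≤ a + l) ∧ (a < p ∧ p ≤ a + l)
  · refine ht (i - a) (j - a) (k - a) (p - a) (by omega) (by omega) (by omega) (by omega) (by omega)
      ⟨?_, ?_, ?_⟩ <;> clear h conv ht hs <;> grind
  · have n1 : ¬ ((a < i ∧ i ≤ a + l) ∧ (a < j ∧ j ≤ a + l)) := fun hc =>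
      hij ⟨hc.1, conv i p j h1 (by omega) (by omega) (by omega) hc.1 hc.2 (by omega) h5 h7 h8⟩
    have n2 : ¬ ((a < k ∧ k ≤ a + l) ∧ (a < j ∧ j ≤ a + l)) := fun hc =>
      n1 ⟨conv k i j (by omega) (by omega) (by omega) (by omega) hc.1 hc.2 (by omega) (by omega) h6
        (h7.trans h8), hc.2⟩
    have n3 : ¬ ((a < k ∧ k ≤ a + l) ∧ (a < p ∧ p ≤ a + l)) := fun hc =>
      hij ⟨conv k i p (by omega) (by omega) (by omega) (by omega) hc.1 hc.2 (by omega) (by omega) h6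
        h7, hc.2⟩
    refine hs (if i ≤ a then i else if i ≤ a + l then a + 1 else i - l + 1)
      (if j ≤ a then j else if j ≤ a + l then a + 1 else j - l + 1)
      (if k ≤ a then k else if k ≤ a + l then a + 1 else k - l + 1)
      (if p ≤ a then p else if p ≤ a + l then a + 1 else p - l + 1) ?_ ?_ ?_ ?_ ?_ ⟨?_, ?_, ?_⟩ <;>
      clear h conv ht hs <;> grind

end Block

/-- Before `a` the statistics come from the first part, between `a` and `b` from the second, and `a`
and the tail are forced to descend. Neither word has a step, and in both of them position `a + 1` of
the first part appears at `b` for the second largest entry. -/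
theorem Merge.sameStat {n a b r : ℕ} {w v₁ v₂ w' s t : ℕ → ℕ} (h : Merge n a b r w v₁ v₂)
    (h' : Block n a (n - a - r) w' s t) (hab : a + 1 < b) (hbn : b + r ≤ n)
    (hp : Parts a (a + r + 1) (b - a) (n - a - r) v₁ v₂) (ht : WInj (n - a - r) t)
    (h₁ : SameStat (a + r + 1) v₁ s) (h₂ : SameStat (n - a - r) v₂ t) : SameStat n w w' := by
  have hr : n - (n - a - r) + 1 = a + r + 1 := by omega
  have hp' := hp.of_sameStat h₁ h₂
  rw [← hr] at hp'
  have hl : b ≤ a + (n - a - r) := by omega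
  have hn : a + (n - a - r) ≤ n := by omega
  have sh := h.shape hab hbn hp
  have sh' := h'.shape hab hl hn hp' ht
  refine ⟨fun i => ?_, fun i => ?_, fun i => iff_of_false (h.not_isStep hab hbn hp i)
    (h'.not_isStep hab hl hn hp' ht i), fun i => ?_, fun i => ?_⟩
  · rcases lt_trichotomy i a with hi | rfl | hi
    · rw [h.isDesc_left hab hbn i hi, h'.isDesc_left (by omega) hn i hi, hr, h₁.desc]
    · exact iff_of_true ⟨hp.one_le, by omega, sh.rl_left.2.2 _ (by omega) (by omega)⟩
        ⟨hp.one_le, by omega, sh'.rl_left.2.2 _ (by omega) (by omega)⟩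
    · rcases Nat.lt_or_ge i b with hib | hib
      · rw [h.isDesc_mid hab hbn i hp hi hib, h'.isDesc_mid hl hn i hi hib, h₂.desc]
      · by_cases hin : i < n
        · exact iff_of_true ⟨by omega, hin, (sh.rl_right i hib hin.le).2.2 _ (by omega) (by omega)⟩
            ⟨by omega, hin, (sh'.rl_right i hib hin.le).2.2 _ (by omega) (by omega)⟩
        · exact iff_of_false (fun hc => hin hc.2.1) (fun hc => hin hc.2.1)
  · rcases Nat.lt_or_ge a i with hi | hi
    · rcases Nat.lt_or_ge i b with hib | hib
      · exact iff_of_false (sh.not_rl i hi hib) (sh'.not_rl i hi hib)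
      · by_cases hin : i ≤ n
        · exact iff_of_true (sh.rl_right i hib hin) (sh'.rl_right i hib hin)
        · exact iff_of_false (fun hc => hin hc.2.1) (fun hc => hin hc.2.1)
    · rw [h.isRL_left hab hbn i hi, h'.isRL_left (by omega) hn i hi, hr, h₁.rl]
  · rw [h.isTop_iff hab hbn hp, h'.isTop_iff hab hl hn hp' ht, hr, h₁.top]
  · rw [h.isSecond_iff hab hbn hp, h'.isSecond_iff hab hl hn hp' ht, hr, h₁.second, h₁.second]

/-! ### Every 2413-avoider of the given shape is an inflation by a block. -/

/-- The entries of `w 1, …, w n` at positions in `[a + 1, e]` are contiguous in value. -/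
def IsInterval (n a e : ℕ) (w : ℕ → ℕ) : Prop :=
  ∀ x, 1 ≤ x → x ≤ n → x ≤ a ∨ e < x →
    (∀ j, a < j → j ≤ e → w x < w j) ∨ (∀ j, a < j → j ≤ e → w j < w x)

section Decomposition

variable {n a b : ℕ} {w : ℕ → ℕ}

/-- Let `e` be the last tail position whose entry is at least some middle entry. Everything after
`e` is below the segment. By 2413-avoidance at `x`, `a`, `y`, `b`, an entry at `x < a` is either
above the entry at `b`, the largest of the segment, or below the whole middle, hence below the entry
at `e` and the rest of the segment. -/
theorem Shape.exists_isInterval (h : Shape n a b w) (hw : WInj n w) (H : Avoid2413 n w) :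
    ∃ e, b ≤ e ∧ e ≤ n ∧ IsInterval n a e w := by
  have hab := h.lt
  have hbn := h.le
  let P : ℕ → Prop := fun e => b ≤ e ∧ ∃ j, a < j ∧ j < b ∧ w j ≤ w e
  classical
  have hP : P b := ⟨le_rfl, b - 1, by omega, by omega,
    (h.lt_top hw (b - 1) (by omega) (by omega) (by omega)).le⟩
  obtain ⟨hbe, j₀, hj₀, hj₀b, hj₀e⟩ : P (Nat.findGreatest P n) := Nat.findGreatest_spec hbn hP
  have hen : Nat.findGreatest P n ≤ n := Nat.findGreatest_le n
  have hmax : ∀ x, Nat.findGreatest P n < x → x ≤ n → ¬ P x := fun x hx hx' =>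
    Nat.findGreatest_is_greatest hx hx'
  generalize Nat.findGreatest P n = e at *
  refine ⟨e, hbe, hen, fun x hx hxn hxe => ?_⟩
  rcases hxe with hxe | hxe
  · rcases eq_or_lt_of_le hxe with rfl | hxa
    · exact Or.inr fun j hj hj' => h.rl_left.2.2 j hj (by omega)
    by_contra! hc
    obtain ⟨⟨j, hj, hj', hjx⟩, ⟨k, hk, hk', hkx⟩⟩ := hc
    have e1 : w k ≤ w b := by
      rcases eq_or_ne k b with rfl | hkb
      · exact le_rfl
      · exact (h.lt_top hw k hk (by omega) hkb).le
    have e2 : w x ≠ w b := fun he => by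
      have := hw x b hx hxn (by omega) hbn he
      omega
    have key : ∀ y, a < y → y < b → w x ≤ w y := by
      intro y hy hyb
      by_contra! hc
      exact H x a y b hx hxa hy hyb hbn ⟨hc, by omega, h.rl_left.2.2 b (by omega) hbn⟩
    have e3 : j ≠ x := by omega
    have e4 : w j ≠ w x := fun he => e3 (hw j x (by omega) (by omega) hx hxn he)
    rcases Nat.lt_or_ge j b with hjb | hjb
    · have := key j hj hjb
      omega
    · have e5 := key j₀ hj₀ hj₀b
      rcases eq_or_lt_of_le hj' with rfl | hje
      · omega
      · have := (h.rl_right j hjb (by omega)).2.2 e hje hen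
        omega
  · refine Or.inl fun j hj hj' => ?_
    rcases Nat.lt_or_ge j b with hjb | hjb
    · by_contra! hc
      exact hmax x hxe hxn ⟨by omega, j, hj, hjb, hc⟩
    · exact (h.rl_right j hjb (by omega)).2.2 x (by omega) hxn

theorem Shape.exists_maximal_isInterval (h : Shape n a b w) (hw : WInj n w) (H : Avoid2413 n w) :
    ∃ e, b ≤ e ∧ e ≤ n ∧ IsInterval n a e w ∧ (e < n → ¬ IsInterval n a (e + 1) w) := by
  classical
  obtain ⟨e, hbe, hen, he⟩ := h.exists_isInterval hw H
  refine ⟨Nat.findGreatest (fun e => IsInterval n a e w) n, hbe.trans (Nat.le_findGreatest hen he),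
    Nat.findGreatest_le n, Nat.findGreatest_spec (P := fun e => IsInterval n a e w) hen he,
    fun hlt => Nat.findGreatest_is_greatest (P := fun e => IsInterval n a e w) (by omega) hlt⟩

/-- The block is represented in `s` by its maximum, at `b`; this choice makes `s` decrease from `a`
on. -/
theorem Shape.block {l : ℕ} {s t : ℕ → ℕ} (h : Shape n a b w) (hbl : b ≤ a + l) (hn : a + l ≤ n)
    (hi : IsInterval n a (a + l) w)
    (h₁ : IsSubword (n - l + 1) n s w
      (fun i => if i ≤ a then i else if i = a + 1 then b else i + l - 1))
    (h₂ : IsSubword l n t w (fun i => i + a)) : Block n a l w s t := by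
  intro i j hi1 hin hj1 hjn
  have hab := h.lt
  by_cases hij : (a < i ∧ i ≤ a + l) ∧ (a < j ∧ j ≤ a + l)
  · rw [if_pos hij, h₂.lt_iff _ _ (by omega) (by omega) (by omega) (by omega),
      show i - a + a = i by omega, show j - a + a = j by omega]
  · rw [if_neg hij, h₁.lt_iff _ _ (by grind) (by grind) (by grind) (by grind)]
    have e1 := hi i hi1 hin
    have e2 := hi j hj1 hjn
    have r : ∀ i, (if (if i ≤ a then i else if i ≤ a + l then a + 1 else i - l + 1) ≤ a then
        if i ≤ a then i else if i ≤ a + l then a + 1 else i - l + 1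
        else if (if i ≤ a then i else if i ≤ a + l then a + 1 else i - l + 1) = a + 1 then b
        else (if i ≤ a then i else if i ≤ a + l then a + 1 else i - l + 1) + l - 1) =
        if a < i ∧ i ≤ a + l then b else i := by
      clear e1 e2 h h₁ h₂ hi
      intro i
      grind
    rw [r, r]
    clear h h₁ h₂ hi r
    grind

/-- Steps of `t`, and steps of `s` not touching the block, are steps of `w` because the block is an
interval. A step of `s` at `a + 1` would allow a longer interval. At `a` a step of `s` is harmless.
-/
theorem Shape.block_parts {l : ℕ} {s t : ℕ → ℕ} (h : Shape n a b w) (hw : WInj n w)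
    (hs : ∀ i, ¬ IsStep n w i) (hbl : b ≤ a + l) (hn : a + l ≤ n)
    (hi : IsInterval n a (a + l) w) (hmax : a + l < n → ¬ IsInterval n a (a + l + 1) w)
    (h₁ : IsSubword (n - l + 1) n s w
      (fun i => if i ≤ a then i else if i = a + 1 then b else i + l - 1))
    (h₂ : IsSubword l n t w (fun i => i + a)) : Parts a (n - l + 1) (b - a) l s t := by
  have hab := h.lt
  have hpos := h.one_le
  refine ⟨hpos, by omega, by omega, by omega, fun i hi' hin => ⟨by omega, hin, fun j hj hjn => ?_⟩,
    fun i ⟨h1, h2, h3, h4⟩ => ?_, fun i hi' hin => ⟨by omega, hin, fun j hj hjl => ?_⟩,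
    fun i ⟨h1, h2, h3, h4⟩ => ?_, by omega, by omega, fun j hj hjl => ?_⟩
  · rw [h₁.lt_iff j i (by omega) (by omega) (by omega) (by omega)]
    have hrl : IsRL n w (if i ≤ a then i else if i = a + 1 then b else i + l - 1) := by
      rcases eq_or_lt_of_le hi' with rfl | hi'
      · rw [if_pos le_rfl]
        exact h.rl_left
      · exact h.rl_right _ (by grind) (by grind)
    exact hrl.2.2 _ (h₁.mono i j (by omega) hj hjn) (h₁.le j (by omega) hjn)
  · by_contra hia
    have e0 := (h₁.lt_iff (i + 1) i (by omega) (by omega) h1 (by omega)).1 h3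
    rcases eq_or_ne i (a + 1) with rfl | hia'
    -- With no value of `s` between the block and the next entry, that entry extends the interval by
    -- one.
    · refine hmax (by omega) fun x hx hxn hxe => ?_
      have e1 := (h.rl_right b le_rfl h.le).2.2 (a + l + 1) (by omega) (by omega)
      rcases hxe with hxe | hxe
      · have e2 := h4 x hx (by omega)
        have e3 := h₁.lt_iff (a + 1 + 1) x (by omega) (by omega) hx (by omega)
        have e4 := h₁.lt_iff x (a + 1) hx (by omega) (by omega) (by omega)
        have e5 : w x ≠ w (a + l + 1) := fun he => by
          have := hw _ _ hx hxn (by omega) (by omega) he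
          omega
        simp only [hxe, if_true, show ¬ a + 1 + 1 ≤ a by omega, show ¬ a + 1 ≤ a by omega,
          show ¬ a + 1 + 1 = a + 1 by omega, if_false, show a + 1 + 1 + l - 1 = a + l + 1 by omega]
          at e3 e4
        rcases hi x hx hxn (Or.inl hxe) with hc | hc
        · refine Or.inl fun j hj hj' => ?_
          rcases eq_or_lt_of_le hj' with rfl | hj'
          · have := hc b (by omega) hbl
            omega
          · exact hc j hj (by omega)
        · refine Or.inr fun j hj hj' => ?_
          rcases eq_or_lt_of_le hj' with rfl | hj'
          · exact e1.trans (hc b (by omega) hbl)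
          · exact hc j hj (by omega)
      · have e2 := (h.rl_right (a + l + 1) (by omega) (by omega)).2.2 x hxe hxn
        rcases hi x hx hxn (Or.inr (by omega)) with hc | hc
        · refine Or.inl fun j hj hj' => ?_
          rcases eq_or_lt_of_le hj' with rfl | hj'
          · exact e2
          · exact hc j hj (by omega)
        · have := hc b (by omega) hbl
          omega
    · have g0 : (if i + 1 ≤ a then i + 1 else if i + 1 = a + 1 then b else i + 1 + l - 1) =
        (if i ≤ a then i else i + l - 1) + 1 := by grind
      have g1 : (if i ≤ a then i else if i = a + 1 then b else i + l - 1) =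
        (if i ≤ a then i else i + l - 1) := by grind
      have g2 : (if i ≤ a then i else i + l - 1) < a ∨
          a + l < (if i ≤ a then i else i + l - 1) := by
        grind
      have g3 : 1 ≤ (if i ≤ a then i else i + l - 1) ∧ (if i ≤ a then i else i + l - 1) < n := by
        grind
      have key : ∀ q, 1 ≤ q → q ≤ n - l + 1 → (¬ w ((if i ≤ a then i else i + l - 1) + 1) <
          w (if q ≤ a then q else if q = a + 1 then b else q + l - 1) ∨
          ¬ w (if q ≤ a then q else if q = a + 1 then b else q + l - 1) <
          w (if i ≤ a then i else i + l - 1)) := by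
        intro q hq hqn
        have e2 := h4 q hq hqn
        have e3 := h₁.lt_iff (i + 1) q (by omega) (by omega) hq hqn
        have e4 := h₁.lt_iff q i hq hqn h1 (by omega)
        rw [g0] at e3
        rw [g1] at e4
        omega
      rw [g0, g1] at e0
      generalize (if i ≤ a then i else i + l - 1) = y at *
      refine hs y ⟨g3.1, g3.2, e0, fun p hp1 hp2 => ?_⟩
      -- `s` sees the block only through `b`, but every entry outside is on the same side of the
      -- whole block.
      by_cases hpl : a < p ∧ p ≤ a + l
      · have k1 := key (a + 1) (by omega) (by omega)
        have k2 := hi y g3.1 (by omega) (by omega)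
        have k3 := hi (y + 1) (by omega) (by omega) (by omega)
        simp only [show ¬ a + 1 ≤ a by omega, if_true, if_false] at k1
        clear h h₁ h₂ hi hw hs hmax key h4
        grind
      · have k1 := key (if p ≤ a then p else p - l + 1) (by grind) (by grind)
        have g4 : (if (if p ≤ a then p else p - l + 1) ≤ a then (if p ≤ a then p else p - l + 1)
          else if (if p ≤ a then p else p - l + 1) = a + 1 then b
          else (if p ≤ a then p else p - l + 1) + l - 1) = p := by grind
        rw [g4] at k1
        omega
  · rw [h₂.lt_iff j i (by omega) (by omega) (by omega) (by omega)]
    exact (h.rl_right _ (by omega) (by omega)).2.2 _ (by omega) (by omega)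
  · refine hs (i + a) ⟨by omega, by omega, ?_, fun p hp1 hp2 => ?_⟩
    · have := (h₂.lt_iff (i + 1) i (by omega) (by omega) (by omega) (by omega)).1 h3
      rwa [show i + 1 + a = i + a + 1 by omega] at this
    · by_cases hpl : p ≤ a ∨ a + l < p
      · rcases hi p hp1 hp2 hpl with hc | hc
        · exact Or.inl (hc _ (by omega) (by omega)).le
        · exact Or.inr (hc _ (by omega) (by omega)).le
      · have e1 := h4 (p - a) (by omega) (by omega)
        have e2 := h₂.lt_iff (i + 1) (p - a) (by omega) (by omega) (by omega) (by omega)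
        have e3 := h₂.lt_iff (p - a) i (by omega) (by omega) (by omega) (by omega)
        rw [show p - a + a = p by omega] at e2 e3
        rw [show i + 1 + a = i + a + 1 by omega] at e2
        omega
  · rcases eq_or_ne j (b - a) with rfl | hne
    · exact le_rfl
    · refine ((h₂.lt_iff j (b - a) (by omega) (by omega) (by omega) (by omega)).2 ?_).le
      rw [show b - a + a = b by omega]
      exact h.lt_top hw _ (by omega) (by omega) (by omega)

/-- If `l < l'`, the longer block contains both `b` and `a + l + 1`, so no prefix entry lies between
them in value. Then `s` has a step at `a + 1`, which `Parts` forbids. Used both ways, this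
determines the length of the block. -/
theorem Block.length_le {l l' m : ℕ} {s t s' t' : ℕ → ℕ} (h : Block n a l w s t)
    (h' : Block n a l' w s' t') (hab : a + 1 < b) (hbl : b ≤ a + l) (hbl' : b ≤ a + l')
    (hn : a + l ≤ n) (hn' : a + l' ≤ n) (hm : m = n - l + 1)
    (hp : Parts a m (b - a) l s t) : l' ≤ l := by
  subst hm
  by_contra! hlt
  have hrl := (hp.rl₁ (a + 1) (by omega) (by omega)).2.2
  refine absurd (hp.step₁ (a + 1) ⟨by omega, by omega, hrl _ (by omega) (by omega),
    fun p hp1 hp2 => ?_⟩) (by omega)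
  rcases Nat.lt_or_ge a p with hpa | hpa
  · rcases eq_or_lt_of_le (Nat.succ_le_of_lt hpa) with rfl | hpa
    · exact Or.inr le_rfl
    · rcases eq_or_lt_of_le (Nat.succ_le_of_lt hpa) with rfl | hpa
      · exact Or.inl le_rfl
      · exact Or.inl ((hp.rl₁ (a + 2) (by omega) (by omega)).2.2 p hpa hp2).le
  · have e1 := h (a + l + 1) p
    have e2 := h p b
    have e3 := h' (a + l + 1) p
    have e4 := h' p b
    clear h h' hp hrl
    grind

/-- In the splitting case, a word that avoids both patterns is an inflation of its parts. -/
theorem Shape.merge_eq_block {r : ℕ} {v₁ v₂ : ℕ → ℕ} (h : Shape n a b w) (hw : WInj n w)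
    (H : Avoid2413 n w) (hs : ∀ i, ¬ IsStep n w i) (hm : Merge n a b r w v₁ v₂)
    (hbn : b + r ≤ n) (hp : Parts a (a + r + 1) (b - a) (n - a - r) v₁ v₂)
    (hv : WInj (n - a - r) v₂) : Block n a (n - a - r) w v₁ v₂ := by
  have hab := h.lt
  have hb := h.lt_top hw (b - 1) (by omega) (by omega) (by omega)
  have hba := h.rl_left.2.2 b (by omega) h.le
  -- Otherwise `x`, `a`, `b - 1`, `b` form 2413.
  have hpre : ∀ x, 1 ≤ x → x < a → w (b - 1) < w x → w b ≤ w x := by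
    intro x hx hxa hlt
    by_contra! hc
    exact H x a (b - 1) b hx hxa (by omega) (by omega) h.le ⟨hlt, hc, hba⟩
  -- If `r > 0`, the middle is below the entry at `b + 1` and the prefix is above the one at `b`, so
  -- `b` is a step.
  have hr : r = 0 := by
    by_contra hr
    have e1 := hm (b - 1) (b + 1)
    refine hs b ⟨by omega, by omega, (h.rl_right b le_rfl h.le).2.2 _ (by omega) (by omega),
      fun p hp hpn => ?_⟩
    rcases lt_trichotomy p a with hpa | rfl | hpa
    · have e2 := hpre p hp hpa
      have e3 := hm (b - 1) p
      clear h H hs hpre hm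
      grind
    · exact Or.inr hba.le
    · rcases lt_trichotomy p b with hpb | rfl | hpb
      · have e3 := hm (b + 1) p
        clear h H hs hpre hm
        grind
      · exact Or.inr le_rfl
      · rcases eq_or_lt_of_le (Nat.succ_le_of_lt hpb) with rfl | hpb
        · exact Or.inl le_rfl
        · exact Or.inl ((h.rl_right (b + 1) (by omega) (by omega)).2.2 p hpb hpn).le
  subst hr
  have hle : ∀ x, 1 ≤ x → x ≤ a → w b < w x := by
    intro x hx hxa
    rcases eq_or_lt_of_le hxa with rfl | hxa
    · exact hba
    · have := hm (b - 1) x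
      have := hpre x hx hxa
      have := hw x b hx (by omega) (by omega) (by omega)
      clear h H hs hpre hm hp
      grind
  have htop : ∀ x, a < x → x ≤ n → x ≠ b → v₂ (x - a) < v₂ (b - a) := by
    intro x hx hxn hxb
    refine lt_of_le_of_ne (hp.top₂.2.2 (x - a) (by omega) (by omega)) fun he => ?_
    have := hv (x - a) (b - a) (by omega) (by omega) (by omega) (by omega) he
    omega
  intro i j hi hin hj hjn
  have e1 := hm i j hi hin hj hjn
  have e2 := hm i b hi hin (by omega) h.le
  have e3 := hm b j (by omega) h.le hj hjn
  have e4 := hle i hi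
  have e5 := hle j hj
  have e6 := htop i
  have e7 := htop j
  have e8 : a < i → i ≠ b → w i < w b := fun hx => h.lt_top hw i hx hin
  have e9 : a < j → j ≠ b → w j < w b := fun hx => h.lt_top hw j hx hjn
  clear h H hs hpre hm hp hle htop hw hv
  by_cases hia : i ≤ a <;> by_cases hja : j ≤ a <;>
    simp only [hia, hja, if_true, if_false] at e1 e2 e3 ⊢ <;> grind

end Decomposition

open Finset

/-! ### From permutations to words. -/

section Entries

variable {n : ℕ} (π τ : Equiv.Perm (Fin n))

theorem entry_eq (i : ℕ) (h : 1 ≤ i) (h' : i ≤ n) :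
    entry π i = (π ⟨i - 1, by omega⟩ : ℕ) + 1 := dif_pos ⟨h, h'⟩

theorem entry_succ (i : Fin n) : entry π (i + 1) = (π i : ℕ) + 1 := by
  rw [entry_eq _ _ (by omega) (by omega)]
  simp

theorem entry_pos (i : ℕ) (h : 1 ≤ i) (h' : i ≤ n) : 1 ≤ entry π i := by
  rw [entry_eq π i h h']
  omega

theorem entry_le (i : ℕ) : entry π i ≤ n := by
  unfold entry
  split <;> omega

theorem wInj_entry : WInj n (entry π) := by
  intro i j hi hin hj hjn h
  rw [entry_eq π i hi hin, entry_eq π j hj hjn] at h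
  have := π.injective (Fin.ext (Nat.succ_injective h))
  simp only [Fin.mk.injEq] at this
  omega

theorem exists_entry_eq (v : ℕ) (h : 1 ≤ v) (h' : v ≤ n) :
    ∃ i, 1 ≤ i ∧ i ≤ n ∧ entry π i = v := by
  refine ⟨(π.symm ⟨v - 1, by omega⟩ : ℕ) + 1, by omega, by omega, ?_⟩
  rw [entry_succ]
  simp
  omega

variable {π τ}

/-- A strictly increasing bijection of `Fin n` onto itself is the identity. -/
theorem perm_ext_lt (h : ∀ i j, 1 ≤ i → i ≤ n → 1 ≤ j → j ≤ n →
    (entry π i < entry π j ↔ entry τ i < entry τ j)) : π = τ := by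
  have hm : StrictMono (τ ∘ π.symm) := by
    intro x y hxy
    have := h (π.symm x + 1) (π.symm y + 1) (by omega) (by omega) (by omega) (by omega)
    simp only [entry_succ, Equiv.apply_symm_apply] at this
    simp only [Function.comp_apply, Fin.lt_def] at hxy ⊢
    omega
  have hid : (τ ∘ π.symm) = id := by
    refine (StrictMono.range_inj hm strictMono_id).1 ?_
    rw [(τ.surjective.comp π.symm.surjective).range_eq, Set.range_id]
  ext i
  have := congrFun hid (π i)
  simp only [Function.comp_apply, Equiv.symm_apply_apply, id_eq] at this
  rw [this]

theorem entry_std_lt {w : ℕ → ℕ} (hw : WInj n w) (i j : ℕ) (hi : 1 ≤ i) (hin : i ≤ n)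
    (hj : 1 ≤ j) (hjn : j ≤ n) : entry (std n w) i < entry (std n w) j ↔ w i < w j := by
  have hinj : Function.Injective fun i : Fin n => w (i + 1) := by
    intro x y hxy
    have := hw (x + 1) (y + 1) (by omega) (by omega) (by omega) (by omega) hxy
    exact Fin.ext (by omega)
  have := std_lt_std_iff hinj ⟨i - 1, by omega⟩ ⟨j - 1, by omega⟩
  rw [entry_eq _ i hi hin, entry_eq _ j hj hjn, Nat.add_lt_add_iff_right, ← Fin.lt_def, this]
  simp only [Nat.sub_add_cancel hi, Nat.sub_add_cancel hj]

theorem isSubword_std {m : ℕ} {w f : ℕ → ℕ} (hw : WInj n w)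
    (pos : ∀ i, 1 ≤ i → i ≤ m → 1 ≤ f i) (le : ∀ i, 1 ≤ i → i ≤ m → f i ≤ n)
    (mono : ∀ i j, 1 ≤ i → i < j → j ≤ m → f i < f j) :
    IsSubword m n (entry (std m fun i => w (f i))) w f where
  pos := pos
  le := le
  mono := mono
  lt_iff i j hi him hj hjm := by
    refine entry_std_lt (fun i j hi him hj hjm h => ?_) i j hi him hj hjm
    have := hw _ _ (pos i hi him) (le i hi him) (pos j hj hjm) (le j hj hjm) h
    rcases lt_trichotomy i j with hij | hij | hij
    · have := mono i j hi hij hjm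
      omega
    · exact hij
    · have := mono j i hj hij him
      omega

theorem eq_of_isSubword {m k : ℕ} {σ τ : Equiv.Perm (Fin m)} {w f : ℕ → ℕ}
    (h : IsSubword m k (entry σ) w f) (h' : IsSubword m k (entry τ) w f) : σ = τ :=
  perm_ext_lt fun i j hi him hj hjm => by
    rw [h.lt_iff i j hi him hj hjm, h'.lt_iff i j hi him hj hjm]

theorem mem_descents (i : ℕ) : i ∈ descents π ↔ IsDesc n (entry π) i := by
  simp [descents, IsDesc, and_assoc]

theorem mem_rlMax (i : ℕ) : i ∈ rlMax π ↔ IsRL n (entry π) i := by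
  simp [rlMax, IsRL, and_assoc]

/-- All values from 1 to n occur, so two values with none in between differ by one. -/
theorem mem_steps (i : ℕ) : i ∈ steps π ↔ IsStep n (entry π) i := by
  simp only [steps, mem_filter, mem_Ico, IsStep, and_assoc]
  refine and_congr_right fun h1 => and_congr_right fun h2 => ⟨fun h => ⟨by omega, by omega⟩, ?_⟩
  rintro ⟨h3, h4⟩
  by_contra hne
  have h5 := entry_le π i
  obtain ⟨j, hj, hjn, hje⟩ := exists_entry_eq π (entry π (i + 1) + 1) (by omega) (by omega)
  have := h4 j hj hjn
  omega

theorem position_eq_iff (v i : ℕ) (hv : 1 ≤ v) (hvn : v ≤ n) (hi : 1 ≤ i) (hin : i ≤ n) :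
    position π v = i ↔ entry π i = v := by
  rw [position, entry_eq _ v hv hvn, entry_eq _ i hi hin]
  constructor
  · rintro rfl
    simp
    omega
  · rintro rfl
    simp
    omega

theorem isTop_iff_entry (i : ℕ) (hi : 1 ≤ i) (hin : i ≤ n) :
    IsTop n (entry π) i ↔ entry π i = n := by
  constructor
  · rintro ⟨-, -, h⟩
    obtain ⟨j, hj, hjn, hje⟩ := exists_entry_eq π n (by omega) le_rfl
    have h1 := h j hj hjn
    have h2 := entry_le π i
    omega
  · intro h
    exact ⟨hi, hin, fun j _ _ => (entry_le π j).trans h.ge⟩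

theorem isSecond_iff_entry (i : ℕ) (hn : 2 ≤ n) (hi : 1 ≤ i) (hin : i ≤ n) :
    IsSecond n (entry π) i ↔ entry π i = n - 1 := by
  obtain ⟨p, hp, hpn, hpe⟩ := exists_entry_eq π n (by omega) le_rfl
  constructor
  · rintro ⟨-, -, q, hq, hqn, hiq, h⟩
    obtain ⟨j, hj, hjn, hje⟩ := exists_entry_eq π (n - 1) (by omega) (by omega)
    have h1 := entry_le π q
    by_cases hjq : j = q
    · subst hjq
      have := h p hp hpn (by rintro rfl; omega)
      omega
    · have := h j hj hjn hjq
      omega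
  · intro h
    refine ⟨hi, hin, p, hp, hpn, by omega, fun j hj hjn hjp => ?_⟩
    have h1 := entry_le π j
    have h2 : entry π j ≠ entry π p := fun he => hjp (wInj_entry π j p hj hjn hp hpn he)
    omega

theorem contains_iff {τ : Fin 4 → ℕ} :
    Contains π τ ↔ ∃ i j k l, 1 ≤ i ∧ i < j ∧ j < k ∧ k < l ∧ l ≤ n ∧
      ∀ x y : Fin 4, entry π (![i, j, k, l] x) < entry π (![i, j, k, l] y) ↔ τ x < τ y := by
  constructor
  · rintro ⟨f, hf⟩
    have h01 : f 0 < f 1 := f.lt_iff_lt.2 (by decide)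
    have h12 : f 1 < f 2 := f.lt_iff_lt.2 (by decide)
    have h23 : f 2 < f 3 := f.lt_iff_lt.2 (by decide)
    refine ⟨f 0 + 1, f 1 + 1, f 2 + 1, f 3 + 1, by omega, by omega, by omega, by omega, by omega,
      fun x y => ?_⟩
    have key : ∀ x : Fin 4, (![(f 0 : ℕ) + 1, (f 1 : ℕ) + 1, (f 2 : ℕ) + 1, (f 3 : ℕ) + 1] x) =
        (f x : ℕ) + 1 := by
      intro x
      fin_cases x <;> rfl
    rw [key, key, entry_succ, entry_succ, ← hf, Fin.lt_def]
    omega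
  · rintro ⟨i, j, k, l, h1, h2, h3, h4, h5, h⟩
    have hpos : ∀ x : Fin 4, 1 ≤ ![i, j, k, l] x ∧ ![i, j, k, l] x ≤ n := by
      intro x
      fin_cases x <;> simp <;> omega
    refine ⟨OrderEmbedding.ofStrictMono
      (fun x => (⟨![i, j, k, l] x - 1, by have := hpos x; omega⟩ : Fin n)) ?_, fun x y => ?_⟩
    · refine Fin.strictMono_iff_lt_succ.2 fun x => ?_
      fin_cases x <;> simp only [Fin.mk_lt_mk] <;> simp <;> omega
    · rw [← h, entry_eq _ _ (hpos x).1 (hpos x).2, entry_eq _ _ (hpos y).1 (hpos y).2]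
      simp only [OrderEmbedding.coe_ofStrictMono, Fin.lt_def]
      omega

theorem mem_avoiders_1423 : π ∈ avoiders n ![1, 4, 2, 3] ↔ Avoid1423 n (entry π) := by
  simp only [avoiders, Set.mem_ofPred_eq, contains_iff, Avoid1423]
  constructor
  · rintro H i j k l h1 h2 h3 h4 h5 ⟨h6, h7, h8⟩
    refine H ⟨i, j, k, l, h1, h2, h3, h4, h5, fun x y => ?_⟩
    fin_cases x <;> fin_cases y <;> simp <;> omega
  · rintro H ⟨i, j, k, l, h1, h2, h3, h4, h5, h⟩
    exact H i j k l h1 h2 h3 h4 h5 ⟨(h 0 2).2 (by decide), (h 2 3).2 (by decide),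
      (h 3 1).2 (by decide)⟩

theorem mem_avoiders_2413 : π ∈ avoiders n ![2, 4, 1, 3] ↔ Avoid2413 n (entry π) := by
  simp only [avoiders, Set.mem_ofPred_eq, contains_iff, Avoid2413]
  constructor
  · rintro H i j k l h1 h2 h3 h4 h5 ⟨h6, h7, h8⟩
    refine H ⟨i, j, k, l, h1, h2, h3, h4, h5, fun x y => ?_⟩
    fin_cases x <;> fin_cases y <;> simp <;> omega
  · rintro H ⟨i, j, k, l, h1, h2, h3, h4, h5, h⟩
    exact H i j k l h1 h2 h3 h4 h5 ⟨(h 2 0).2 (by decide), (h 0 3).2 (by decide),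
      (h 3 1).2 (by decide)⟩

end Entries

/-! ### Inflation, deletion and insertion of permutations realize the word relations, which
determine their ingredients. -/

section Operations

variable {n : ℕ}

theorem wInj_inflateWord {m l : ℕ} (σ : Equiv.Perm (Fin m)) (α : Equiv.Perm (Fin l)) {p : ℕ}
    (hp : 1 ≤ p) (hpm : p ≤ m) (hl : 1 ≤ l) (hn : m + l = n + 1) :
    WInj n (inflateWord σ α p) := by
  intro i j hi hin hj hjn h
  have s1 := wInj_entry σ (if i < p then i else i - l + 1) (if j < p then j else j - l + 1)
  have s2 := wInj_entry σ (if i < p then i else i - l + 1) p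
  have s3 := wInj_entry σ (if j < p then j else j - l + 1) p
  have a1 := wInj_entry α (i - p + 1) (j - p + 1)
  have b1 := entry_pos α (i - p + 1)
  have b2 := entry_pos α (j - p + 1)
  have b3 := entry_le α (i - p + 1)
  have b4 := entry_le α (j - p + 1)
  have b5 := entry_pos σ p hp hpm
  simp only [inflateWord] at h
  by_cases hi1 : i < p <;> by_cases hj1 : j < p <;>
    simp only [hi1, hj1, if_true, if_false] at h s1 s2 s3 <;> grind

theorem block_inflate {m l a : ℕ} (σ : Equiv.Perm (Fin m)) (α : Equiv.Perm (Fin l))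
    (hm : a < m) (hl : 1 ≤ l) (hn : m + l = n + 1) :
    Block n a l (entry (inflate n σ α (a + 1))) (entry σ) (entry α) := by
  intro i j hi hin hj hjn
  rw [inflate, entry_std_lt (wInj_inflateWord σ α (by omega) (by omega) hl hn) i j hi hin hj hjn]
  have s1 := wInj_entry σ (if i ≤ a then i else i - l + 1) (a + 1)
  have s2 := wInj_entry σ (if j ≤ a then j else j - l + 1) (a + 1)
  have b1 := entry_pos α (i - (a + 1) + 1)
  have b2 := entry_pos α (j - (a + 1) + 1)
  have b3 := entry_le α (i - (a + 1) + 1)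
  have b4 := entry_le α (j - (a + 1) + 1)
  have b5 := entry_pos σ (a + 1) (by omega) (by omega)
  have r1 : a < i → i - (a + 1) + 1 = i - a := by omega
  have r2 : a < j → j - (a + 1) + 1 = j - a := by omega
  simp only [inflateWord]
  by_cases hi1 : i ≤ a <;> by_cases hj1 : j ≤ a <;>
    simp only [hi1, hj1, if_true, if_false, Nat.lt_succ_iff] at s1 s2 ⊢ <;> grind

theorem splitAt_inflate {k : ℕ} (hk : 1 ≤ k) (hkn : k < n) (π : Equiv.Perm (Fin (n - 1))) :
    SplitAt n k (entry (inflate n π (Equiv.swap (0 : Fin 2) 1) k)) (entry π) := by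
  obtain ⟨a, rfl⟩ := Nat.exists_eq_add_of_le' hk
  have h := block_inflate (n := n) (a := a) (l := 2) π (Equiv.swap (0 : Fin 2) 1) (by omega)
    (by omega) (by omega)
  have t1 : entry (Equiv.swap (0 : Fin 2) 1) 1 = 2 := by decide
  have t2 : entry (Equiv.swap (0 : Fin 2) 1) 2 = 1 := by decide
  intro i j hi hin hj hjn
  have r : ∀ i, (if i ≤ a then i else if i ≤ a + 2 then a + 1 else i - 2 + 1) =
      if i ≤ a + 1 then i else i - 1 := by grind
  rw [h i j hi hin hj hjn, r, r]
  generalize entry (Equiv.swap (0 : Fin 2) 1) = t at *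
  clear h r
  grind

theorem splitAt_deleteAt {k : ℕ} {π : Equiv.Perm (Fin n)} (h : IsStep n (entry π) k) :
    SplitAt n k (entry π) (entry (deleteAt π (k + 1))) := by
  obtain ⟨h1, h2, h3, h4⟩ := h
  have hd : deleteAt π (k + 1) =
      std (n - 1) fun i => entry π ((fun i => if i < k + 1 then i else i + 1) i) := by
    simp only [deleteAt, apply_ite (entry π)]
  have hs := isSubword_std (m := n - 1) (wInj_entry π)
    (f := fun i => if i < k + 1 then i else i + 1) (by grind) (by grind) (by grind)
  rw [← hd] at hs
  intro i j hi hin hj hjn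
  have e1 := hs.lt_iff (if i ≤ k then i else i - 1) (if j ≤ k then j else j - 1)
  have e2 := h4 i hi hin
  have e3 := h4 j hj hjn
  have e4 := wInj_entry π i (k + 1) hi hin (by omega) (by omega)
  have e5 := wInj_entry π j (k + 1) hj hjn (by omega) (by omega)
  have e6 := wInj_entry π i k hi hin (by omega) (by omega)
  have e7 := wInj_entry π j k hj hjn (by omega) (by omega)
  clear hs hd h4
  by_cases hij : (i = k ∨ i = k + 1) ∧ (j = k ∨ j = k + 1)
  · rw [if_pos hij]
    grind
  · rw [if_neg hij, e1 (by grind) (by grind) (by grind) (by grind)]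
    grind

theorem insertTop_insertMax {b : ℕ} (hb : 1 ≤ b) (hbn : b ≤ n) (π : Equiv.Perm (Fin (n - 1))) :
    InsertTop n b (entry (insertMax π b)) (entry π) := by
  have hle : ∀ i, entry π i < n := fun i => (entry_le π i).trans_lt (by omega)
  intro i j hi hin hj hjn
  rw [insertMax, entry_std_lt ?_ i j hi hin hj hjn]
  · have e1 := hle i
    have e2 := hle j
    have e3 := hle (i - 1)
    have e4 := hle (j - 1)
    clear hle
    grind
  · intro i j hi hin hj hjn h
    have e1 := wInj_entry π (if i < b then i else i - 1) (if j < b then j else j - 1)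
    have e2 := hle (if i < b then i else i - 1)
    have e3 := hle (if j < b then j else j - 1)
    clear hle
    grind

theorem insertTop_deleteAt {b : ℕ} {π : Equiv.Perm (Fin n)} (h : IsTop n (entry π) b) :
    InsertTop n b (entry π) (entry (deleteAt π b)) := by
  obtain ⟨h1, h2, h3⟩ := h
  have hd : deleteAt π b =
      std (n - 1) fun i => entry π ((fun i => if i < b then i else i + 1) i) := by
    simp only [deleteAt, apply_ite (entry π)]
  have hs := isSubword_std (m := n - 1) (wInj_entry π)
    (f := fun i => if i < b then i else i + 1) (by grind) (by grind) (by grind)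
  rw [← hd] at hs
  intro i j hi hin hj hjn
  have e1 := hs.lt_iff (if i < b then i else i - 1) (if j < b then j else j - 1)
  have e2 := h3 i hi hin
  have e3 := h3 j hj hjn
  have e4 := wInj_entry π i b hi hin h1 h2
  clear hs hd h3
  grind

theorem SplitAt.ext {k : ℕ} {π τ : Equiv.Perm (Fin n)} {v : ℕ → ℕ} (h : SplitAt n k (entry π) v)
    (h' : SplitAt n k (entry τ) v) : π = τ :=
  perm_ext_lt fun i j hi hin hj hjn => by rw [h i j hi hin hj hjn, h' i j hi hin hj hjn]

theorem SplitAt.unique {k : ℕ} {w : ℕ → ℕ} {π τ : Equiv.Perm (Fin (n - 1))}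
    (h : SplitAt n k w (entry π)) (h' : SplitAt n k w (entry τ)) (hk : 1 ≤ k) (hn : k < n) :
    π = τ :=
  eq_of_isSubword (h.isSubword hk hn) (h'.isSubword hk hn)

theorem InsertTop.ext {b : ℕ} {π τ : Equiv.Perm (Fin n)} {v : ℕ → ℕ}
    (h : InsertTop n b (entry π) v) (h' : InsertTop n b (entry τ) v) : π = τ :=
  perm_ext_lt fun i j hi hin hj hjn => by rw [h i j hi hin hj hjn, h' i j hi hin hj hjn]

theorem InsertTop.unique {b : ℕ} {w : ℕ → ℕ} {π τ : Equiv.Perm (Fin (n - 1))}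
    (h : InsertTop n b w (entry π)) (h' : InsertTop n b w (entry τ)) : π = τ :=
  eq_of_isSubword h.isSubword h'.isSubword

theorem Merge.ext {a b r : ℕ} {π τ : Equiv.Perm (Fin n)} {v₁ v₂ : ℕ → ℕ}
    (h : Merge n a b r (entry π) v₁ v₂) (h' : Merge n a b r (entry τ) v₁ v₂) : π = τ :=
  perm_ext_lt fun i j hi hin hj hjn => by rw [h i j hi hin hj hjn, h' i j hi hin hj hjn]

theorem Block.ext {a l : ℕ} {π τ : Equiv.Perm (Fin n)} {s t : ℕ → ℕ}
    (h : Block n a l (entry π) s t) (h' : Block n a l (entry τ) s t) : π = τ :=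
  perm_ext_lt fun i j hi hin hj hjn => by rw [h i j hi hin hj hjn, h' i j hi hin hj hjn]

theorem Block.unique_right {a l : ℕ} {w s s' : ℕ → ℕ} {α β : Equiv.Perm (Fin l)}
    (h : Block n a l w s (entry α)) (h' : Block n a l w s' (entry β)) (hn : a + l ≤ n) : α = β :=
  perm_ext_lt fun i j hi hin hj hjn => by
    rw [h.lt_of_right hn i j hi hin hj hjn, h'.lt_of_right hn i j hi hin hj hjn]

theorem Block.unique_left {m a l : ℕ} {w t t' : ℕ → ℕ} {σ τ : Equiv.Perm (Fin m)}
    (h : Block n a l w (entry σ) t) (h' : Block n a l w (entry τ) t') (hl : 1 ≤ l)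
    (hn : a + l ≤ n) (hm : m = n - l + 1) : σ = τ := by
  subst hm
  refine perm_ext_lt fun i j hi hin hj hjn => ?_
  rcases eq_or_ne i j with rfl | hij
  · simp
  rw [h.lt_of_left hl hn i j (if i ≤ a + 1 then i else i + l - 1)
      (if j ≤ a + 1 then j else j + l - 1) hi hin hj hjn hij (by grind) (by grind),
    h'.lt_of_left hl hn i j (if i ≤ a + 1 then i else i + l - 1)
      (if j ≤ a + 1 then j else j + l - 1) hi hin hj hjn hij (by grind) (by grind)]

end Operations

/-! ### The parameters of `Theta` and its three recursive cases. -/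

section ThetaCases

variable {n : ℕ} {π : Equiv.Perm (Fin n)}

theorem phiB_spec (π : Equiv.Perm (Fin n)) :
    1 ≤ phiB π ∧ ∀ i, phiB π ≤ i → i ≤ n → IsRL n (entry π) i := by
  have hb : 1 ≤ phiB π ∧ Icc (phiB π) n ⊆ rlMax π :=
    Nat.find_spec (p := fun b => 1 ≤ b ∧ Icc b n ⊆ rlMax π) _
  exact ⟨hb.1, fun i hi hin => (mem_rlMax i).1 (hb.2 (mem_Icc.2 ⟨hi, hin⟩))⟩

theorem not_isRL_of_lt_phiB (h : 2 ≤ phiB π) : ¬ IsRL n (entry π) (phiB π - 1) := by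
  intro hc
  refine Nat.find_min (p := fun b => 1 ≤ b ∧ Icc b n ⊆ rlMax π) ⟨n + 1, by simp⟩
    (m := phiB π - 1) (Nat.sub_lt (by omega) one_pos) ⟨by omega, fun i hi => (mem_rlMax i).2 ?_⟩
  rw [mem_Icc] at hi
  rcases eq_or_lt_of_le hi.1 with rfl | hlt
  · exact hc
  · exact (phiB_spec π).2 i (by omega) hi.2

theorem le_phiA {i : ℕ} (h : IsRL n (entry π) i) (hi : i < phiB π) : i ≤ phiA π := by
  refine le_sup (f := id) (mem_sdiff.2 ⟨(mem_rlMax i).2 h, fun hc => ?_⟩)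
  rw [mem_Icc] at hc
  omega

theorem phiA_mem (h : phiA π ≠ 0) : IsRL n (entry π) (phiA π) ∧ phiA π < phiB π := by
  have hne : (rlMax π \ Icc (phiB π) n).Nonempty := by
    by_contra hc
    rw [not_nonempty_iff_eq_empty] at hc
    exact h (by simp [phiA, hc])
  obtain ⟨c, hc, hce⟩ := exists_mem_eq_sup _ hne (id : ℕ → ℕ)
  have hca : phiA π = c := hce
  rw [← hca, mem_sdiff, mem_rlMax, mem_Icc] at hc
  refine ⟨hc.1, ?_⟩
  have := hc.1.2.1
  by_contra hcon
  exact hc.2 ⟨by omega, this⟩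

theorem shape_of_phiA_ne_zero (h : phiA π ≠ 0) : Shape n (phiA π) (phiB π) (entry π) where
  one_le := Nat.pos_of_ne_zero h
  lt := phiA_add_one_lt_phiB π h
  le := phiB_le π ((phiA_mem h).1.1.trans (phiA_mem h).1.2.1)
  rl_left := (phiA_mem h).1
  rl_right := (phiB_spec π).2
  not_rl i hi hib hc := absurd (le_phiA hc hib) (by omega)

theorem Shape.phiB_eq {a b : ℕ} (h : Shape n a b (entry π)) : phiB π = b := by
  have hlt := h.lt
  have hle := h.le
  have hs := phiB_spec π
  rcases lt_trichotomy (phiB π) b with hb | hb | hb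
  · exact absurd (hs.2 (b - 1) (by omega) (by omega)) (h.not_rl _ (by omega) (by omega))
  · exact hb
  · have hn := phiB_le π (by omega)
    exact absurd (h.rl_right (phiB π - 1) (by omega) (by omega)) (not_isRL_of_lt_phiB (by omega))

theorem Shape.phiA_eq {a b : ℕ} (h : Shape n a b (entry π)) : phiA π = a := by
  have hb := h.phiB_eq
  have hlt := h.lt
  have hpos := h.one_le
  have h1 := le_phiA h.rl_left (by omega)
  have h2 := phiA_mem (π := π) (by omega)
  by_contra hne
  exact h.not_rl _ (by omega) (by omega) h2.1

/-- The position of n is a right-to-left maximum, so it is not before the decreasing tail; hence it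
is where the tail starts. -/
theorem isTop_phiB (hn : 1 ≤ n) (h : phiA π = 0) : IsTop n (entry π) (phiB π) := by
  obtain ⟨p, hp, hpn, hpe⟩ := exists_entry_eq π n hn le_rfl
  have ht := (isTop_iff_entry p hp hpn).2 hpe
  have hrl : IsRL n (entry π) p := ⟨hp, hpn, fun j hj hjn =>
    lt_of_le_of_ne (ht.2.2 j (by omega) hjn) fun he => by
      have := wInj_entry π j p (by omega) hjn hp hpn he
      omega⟩
  have hb := phiB_le π hn
  rcases lt_trichotomy p (phiB π) with hlt | rfl | hlt
  · have := le_phiA hrl hlt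
    omega
  · exact ht
  · have h1 := ((phiB_spec π).2 _ le_rfl hb).2.2 p hlt hpn
    have h2 := entry_le π (phiB π)
    omega

/-- The tail decreases, so the entries after `b` that exceed the whole middle form an initial run;
its length is their number. -/
theorem Shape.rho_spec {a b : ℕ} (h : Shape n a b (entry π)) (i : ℕ) (hi : b < i) (hin : i ≤ n) :
    (∀ j, a < j → j < b → entry π j < entry π i) ↔ i ≤ b + rho π := by
  have hB := h.phiB_eq
  have hA := h.phiA_eq
  have hmem : ∀ x, x ∈ ({i ∈ rlMax π | phiB π < i ∧ chi π < entry π i} : Finset ℕ) ↔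
      b < x ∧ x ≤ n ∧ ∀ j, a < j → j < b → entry π j < entry π x := by
    intro x
    rw [mem_filter, mem_rlMax, hB]
    constructor
    · rintro ⟨h1, h2, h3⟩
      refine ⟨h2, h1.2.1, fun j hj hjb => lt_of_le_of_lt ?_ h3⟩
      exact le_sup (f := entry π) (mem_Ioo.2 ⟨hA ▸ hj, hB ▸ hjb⟩)
    · rintro ⟨h1, h2, h3⟩
      refine ⟨h.rl_right x h1.le h2, h1, ?_⟩
      rw [chi, hA, hB, Finset.sup_lt_iff (entry_pos π x (by omega) h2)]
      intro j hj
      rw [mem_Ioo] at hj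
      exact h3 j hj.1 hj.2
  constructor
  · intro H
    have hsub : Ioc b i ⊆ ({i ∈ rlMax π | phiB π < i ∧ chi π < entry π i} : Finset ℕ) := by
      intro x hx
      rw [mem_Ioc] at hx
      refine (hmem x).2 ⟨hx.1, by omega, fun j hj hjb => (H j hj hjb).trans_le ?_⟩
      rcases eq_or_lt_of_le hx.2 with rfl | hlt
      · exact le_rfl
      · exact ((h.rl_right x hx.1.le (by omega)).2.2 i hlt hin).le
    have := card_le_card hsub
    rw [Nat.card_Ioc] at this
    rw [rho]
    omega
  · intro H
    by_contra hc
    have hsub : ({i ∈ rlMax π | phiB π < i ∧ chi π < entry π i} : Finset ℕ) ⊆ Ioo b i := by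
      intro x hx
      rw [hmem] at hx
      refine mem_Ioo.2 ⟨hx.1, ?_⟩
      by_contra hxi
      refine hc fun j hj hjb => (hx.2.2 j hj hjb).trans_le ?_
      rcases eq_or_lt_of_le (not_lt.1 hxi) with rfl | hlt
      · exact le_rfl
      · exact ((h.rl_right i hi.le hin).2.2 x hlt hx.2.1).le
    have := card_le_card hsub
    rw [Nat.card_Ioo] at this
    rw [rho] at H
    omega

theorem Shape.rho_eq {a b r : ℕ} (h : Shape n a b (entry π)) (hbr : b + r ≤ n)
    (hr : ∀ i, b < i → i ≤ n →
      ((∀ j, a < j → j < b → entry π j < entry π i) ↔ i ≤ b + r)) : rho π = r := by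
  have hle := rho_le π
  have hb := h.le
  rw [h.phiB_eq] at hle
  have key : ∀ i, b < i → i ≤ n → (i ≤ b + rho π ↔ i ≤ b + r) := fun i hi hin =>
    (h.rho_spec i hi hin).symm.trans (hr i hi hin)
  have k1 := key (b + r)
  have k2 := key (b + rho π)
  omega

theorem isSubword_part1 (h : phiA π ≠ 0) :
    IsSubword (phiA π + rho π + 1) n (entry (part1 π)) (entry π)
      (fun i => if i ≤ phiA π then i else i - (phiA π + 1) + phiB π) := by
  have h1 := phiA_add_one_lt_phiB π h
  have h2 := rho_le π
  have h3 := (shape_of_phiA_ne_zero h).le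
  have := isSubword_std (m := phiA π + rho π + 1) (wInj_entry π)
    (f := fun i => if i ≤ phiA π then i else i - (phiA π + 1) + phiB π)
    (by grind) (by grind) (by grind)
  simpa only [part1, apply_ite (entry π)] using this

theorem isSubword_part2 (h : phiA π ≠ 0) :
    IsSubword (n - phiA π - rho π) n (entry (part2 π)) (entry π)
      (fun i => if i + phiA π ≤ phiB π then i + phiA π else i + phiA π + rho π) := by
  have h1 := phiA_add_one_lt_phiB π h
  have h2 := rho_le π
  have h3 := (shape_of_phiA_ne_zero h).le
  have := isSubword_std (m := n - phiA π - rho π) (wInj_entry π)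
    (f := fun i => if i + phiA π ≤ phiB π then i + phiA π else i + phiA π + rho π)
    (by grind) (by grind) (by grind)
  simpa only [part2, apply_ite (entry π)] using this

theorem theta_of_isStep {k : ℕ} (hk : IsStep n (entry π) k)
    (hmin : ∀ i, IsStep n (entry π) i → k ≤ i) :
    Theta n π = inflate n (Theta (n - 1) (deleteAt π (k + 1))) (Equiv.swap (0 : Fin 2) 1) k := by
  have hn : ¬ n ≤ 1 := by
    have := hk.1
    have := hk.2.1
    omega
  have hs : (steps π).Nonempty := ⟨k, (mem_steps k).2 hk⟩
  have hm : (steps π).min' hs = k :=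
    le_antisymm (min'_le _ _ ((mem_steps k).2 hk)) (hmin _ ((mem_steps _).1 (min'_mem _ hs)))
  rw [Theta, dif_neg hn, dif_pos hs]
  simp only [hm]

theorem steps_eq_empty (h : ∀ i, ¬ IsStep n (entry π) i) : ¬ (steps π).Nonempty := by
  rintro ⟨k, hk⟩
  exact h k ((mem_steps k).1 hk)

theorem theta_of_phiA_eq_zero (hn : 2 ≤ n) (hs : ∀ i, ¬ IsStep n (entry π) i) (h : phiA π = 0) :
    Theta n π = insertMax (Theta (n - 1) (deleteAt π (phiB π))) (phiB π) := by
  have ht := isTop_phiB (by omega) h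
  have hp : position π n = phiB π := (position_eq_iff n (phiB π) (by omega) le_rfl ht.1 ht.2.1).2
    ((isTop_iff_entry _ ht.1 ht.2.1).1 ht)
  rw [Theta, dif_neg (by omega), dif_neg (steps_eq_empty hs), dif_pos h, hp]

/-- The parts are described only by their order relations, so this also applies to a permutation
assembled from two given parts, as surjectivity needs. -/
theorem Shape.theta_eq {a b r m₁ m₂ : ℕ} (h : Shape n a b (entry π))
    (hs : ∀ i, ¬ IsStep n (entry π) i) (hbr : b + r ≤ n)
    (hr : ∀ i, b < i → i ≤ n →
      ((∀ j, a < j → j < b → entry π j < entry π i) ↔ i ≤ b + r))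
    (hm₁ : m₁ = a + r + 1) (hm₂ : m₂ = n - a - r)
    {σ : Equiv.Perm (Fin m₁)} {τ : Equiv.Perm (Fin m₂)}
    (h₁ : IsSubword m₁ n (entry σ) (entry π) (fun i => if i ≤ a then i else i - (a + 1) + b))
    (h₂ : IsSubword m₂ n (entry τ) (entry π)
      (fun i => if i + a ≤ b then i + a else i + a + r)) :
    Theta n π = inflate n (Theta m₁ σ) (Theta m₂ τ) (a + 1) := by
  have hn := h.le
  have hab := h.lt
  have hpos := h.one_le
  have hA := h.phiA_eq
  have hB := h.phiB_eq
  have hR := h.rho_eq hbr hr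
  subst hA hB hR hm₁ hm₂
  have hne : phiA π ≠ 0 := by omega
  obtain rfl := eq_of_isSubword h₁ (isSubword_part1 hne)
  obtain rfl := eq_of_isSubword h₂ (isSubword_part2 hne)
  rw [Theta, dif_neg (by omega), dif_neg (steps_eq_empty hs), dif_neg hne]

end ThetaCases

namespace SameStat

variable {n : ℕ} {u v w : ℕ → ℕ}

theorem symm (h : SameStat n u v) : SameStat n v u :=
  ⟨fun i => (h.desc i).symm, fun i => (h.rl i).symm, fun i => (h.step i).symm,
    fun i => (h.top i).symm, fun i => (h.second i).symm⟩

theorem trans (h : SameStat n u v) (h' : SameStat n v w) : SameStat n u w :=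
  ⟨fun i => (h.desc i).trans (h'.desc i), fun i => (h.rl i).trans (h'.rl i),
    fun i => (h.step i).trans (h'.step i), fun i => (h.top i).trans (h'.top i),
    fun i => (h.second i).trans (h'.second i)⟩

theorem shape {a b : ℕ} (h : SameStat n u v) (hs : Shape n a b u) : Shape n a b v where
  one_le := hs.one_le
  lt := hs.lt
  le := hs.le
  rl_left := (h.rl a).1 hs.rl_left
  rl_right i hi hin := (h.rl i).1 (hs.rl_right i hi hin)
  not_rl i hi hib hc := hs.not_rl i hi hib ((h.rl i).2 hc)

theorem rlMax_eq {π τ : Equiv.Perm (Fin n)} (h : SameStat n (entry π) (entry τ)) :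
    rlMax π = rlMax τ := by
  ext i
  rw [mem_rlMax, mem_rlMax, h.rl]

theorem phiB_eq {π τ : Equiv.Perm (Fin n)} (h : SameStat n (entry π) (entry τ)) :
    phiB π = phiB τ := by
  simp only [phiB, h.rlMax_eq]

theorem phiA_eq {π τ : Equiv.Perm (Fin n)} (h : SameStat n (entry π) (entry τ)) :
    phiA π = phiA τ := by
  rw [phiA, phiA, h.rlMax_eq, h.phiB_eq]

end SameStat

/-! ### The induction claim and the decompositions of permutations. -/

section Induction

variable {n : ℕ}

/-- The properties of `Theta` on permutations of length `n` that are proved by induction. -/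
structure ThetaSpec (n : ℕ) : Prop where
  avoid : ∀ π, Avoid1423 n (entry π) → Avoid2413 n (entry (Theta n π))
  stat : ∀ π, Avoid1423 n (entry π) → SameStat n (entry π) (entry (Theta n π))
  inj : ∀ π τ, Avoid1423 n (entry π) → Avoid1423 n (entry τ) → Theta n π = Theta n τ → π = τ
  surj : ∀ τ, Avoid2413 n (entry τ) → ∃ π, Avoid1423 n (entry π) ∧ Theta n π = τ
  fixed : ∀ π, Avoid1423 n (entry π) → Avoid2413 n (entry π) → Theta n π = π

/-- The smallest step of the word `w 1, …, w n` is at position `k`. -/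
def IsMinStep (n : ℕ) (w : ℕ → ℕ) (k : ℕ) : Prop :=
  IsStep n w k ∧ ∀ i, IsStep n w i → k ≤ i

theorem SameStat.isMinStep {w v : ℕ → ℕ} (h : SameStat n w v) {k : ℕ} (hk : IsMinStep n w k) :
    IsMinStep n v k :=
  ⟨(h.step k).1 hk.1, fun i hi => hk.2 i ((h.step i).2 hi)⟩

theorem theta_cases (π : Equiv.Perm (Fin n)) :
    (∃ k, IsMinStep n (entry π) k) ∨ (∀ i, ¬ IsStep n (entry π) i) ∧
      (phiA π = 0 ∨ ∃ a b, Shape n a b (entry π)) := by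
  by_cases hs : ∃ k, IsStep n (entry π) k
  · classical
    exact Or.inl ⟨Nat.find hs, Nat.find_spec hs, fun i hi => Nat.find_min' hs hi⟩
  · push Not at hs
    refine Or.inr ⟨hs, ?_⟩
    by_cases h : phiA π = 0
    · exact Or.inl h
    · exact Or.inr ⟨_, _, shape_of_phiA_ne_zero h⟩

theorem splitAt_theta {k : ℕ} {π : Equiv.Perm (Fin n)} (hk : IsMinStep n (entry π) k) :
    SplitAt n k (entry π) (entry (deleteAt π (k + 1))) ∧
      SplitAt n k (entry (Theta n π)) (entry (Theta (n - 1) (deleteAt π (k + 1)))) := by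
  refine ⟨splitAt_deleteAt hk.1, ?_⟩
  rw [theta_of_isStep hk.1 hk.2]
  exact splitAt_inflate hk.1.1 hk.1.2.1 _

theorem insertTop_theta {π : Equiv.Perm (Fin n)} (hn : 2 ≤ n) (hs : ∀ i, ¬ IsStep n (entry π) i)
    (h : phiA π = 0) :
    InsertTop n (phiB π) (entry π) (entry (deleteAt π (phiB π))) ∧
      InsertTop n (phiB π) (entry (Theta n π)) (entry (Theta (n - 1) (deleteAt π (phiB π)))) := by
  refine ⟨insertTop_deleteAt (isTop_phiB (by omega) h), ?_⟩
  rw [theta_of_phiA_eq_zero hn hs h]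
  exact insertTop_insertMax (phiB_spec π).1 (phiB_le π (by omega)) _

theorem Shape.exists_merge {a b : ℕ} {π : Equiv.Perm (Fin n)} (h : Shape n a b (entry π))
    (hs : ∀ i, ¬ IsStep n (entry π) i) (H : Avoid1423 n (entry π)) :
    ∃ (r : ℕ) (σ : Equiv.Perm (Fin (a + r + 1))) (α : Equiv.Perm (Fin (n - a - r))),
      b + r ≤ n ∧ Merge n a b r (entry π) (entry σ) (entry α) ∧
      Parts a (a + r + 1) (b - a) (n - a - r) (entry σ) (entry α) ∧
      Avoid1423 (a + r + 1) (entry σ) ∧ Avoid1423 (n - a - r) (entry α) ∧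
      (Avoid2413 n (entry π) → Avoid2413 (a + r + 1) (entry σ) ∧ Avoid2413 (n - a - r) (entry α)) ∧
      Block n a (n - a - r) (entry (Theta n π)) (entry (Theta (a + r + 1) σ))
        (entry (Theta (n - a - r) α)) := by
  obtain ⟨ha, hb⟩ : phiA π = a ∧ phiB π = b := ⟨h.phiA_eq, h.phiB_eq⟩
  subst ha hb
  have hab := h.lt
  have hne : phiA π ≠ 0 := by
    have := h.one_le
    omega
  have hr := h.rho_spec
  have hbr : phiB π + rho π ≤ n := by
    have := rho_le π
    have := h.le
    omega
  have h₁ := isSubword_part1 hne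
  have h₂ := isSubword_part2 hne
  have hw := wInj_entry π
  refine ⟨rho π, part1 π, part2 π, hbr, h.merge hw H hbr hr h₁ h₂, h.parts hw H hs hbr hr h₁ h₂,
    h₁.avoid1423 H, h₂.avoid1423 H, fun H' => ⟨h₁.avoid2413 H', h₂.avoid2413 H'⟩, ?_⟩
  rw [h.theta_eq hs hbr hr rfl rfl h₁ h₂]
  exact block_inflate _ _ (by omega) (by omega) (by omega)

theorem exists_perm_merge {a b r : ℕ} (hab : a + 1 < b) (hbr : b + r ≤ n)
    (σ : Equiv.Perm (Fin (a + r + 1))) (α : Equiv.Perm (Fin (n - a - r))) :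
    ∃ π : Equiv.Perm (Fin n), Merge n a b r (entry π) (entry σ) (entry α) := by
  refine ⟨std n fun i => if i ≤ a ∨ b ≤ i ∧ i ≤ b + r then
    -- The shift by n lifts the high entries above all entries of `α`.
    n + entry σ (if i ≤ a then i else i - b + a + 1)
    else entry α (if i ≤ b then i - a else i - a - r), fun i j hi hin hj hjn => ?_⟩
  have pos : ∀ i, 1 ≤ i → i ≤ n → (i ≤ a ∨ b ≤ i ∧ i ≤ b + r) →
      1 ≤ entry σ (if i ≤ a then i else i - b + a + 1) := fun i hi hin h =>
    entry_pos σ _ (by grind) (by grind)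
  have le : ∀ i, entry α i ≤ n := fun i => (entry_le α i).trans (by omega)
  rw [entry_std_lt ?_ i j hi hin hj hjn]
  · have e1 := pos i hi hin
    have e2 := pos j hj hjn
    have e3 := le (if i ≤ b then i - a else i - a - r)
    have e4 := le (if j ≤ b then j - a else j - a - r)
    clear pos le
    by_cases hi1 : i ≤ a ∨ b ≤ i ∧ i ≤ b + r <;> by_cases hj1 : j ≤ a ∨ b ≤ j ∧ j ≤ b + r <;>
      simp only [hi1, hj1, if_true, if_false, true_and, false_and, true_or, false_or, forall_const]
        at e1 e2 ⊢ <;> grind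
  · intro i j hi hin hj hjn h
    have e1 := pos i hi hin
    have e2 := pos j hj hjn
    have e3 := le (if i ≤ b then i - a else i - a - r)
    have e4 := le (if j ≤ b then j - a else j - a - r)
    have e5 := wInj_entry σ (if i ≤ a then i else i - b + a + 1)
      (if j ≤ a then j else j - b + a + 1)
    have e6 := wInj_entry α (if i ≤ b then i - a else i - a - r)
      (if j ≤ b then j - a else j - a - r)
    clear pos le
    by_cases hi1 : i ≤ a ∨ b ≤ i ∧ i ≤ b + r <;> by_cases hj1 : j ≤ a ∨ b ≤ j ∧ j ≤ b + r <;>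
      simp only [hi1, hj1, if_true, if_false, forall_const] at e1 e2 h
    · grind
    · omega
    · omega
    · grind

theorem Shape.exists_block {a b : ℕ} {τ : Equiv.Perm (Fin n)} (h : Shape n a b (entry τ))
    (hs : ∀ i, ¬ IsStep n (entry τ) i) (H : Avoid2413 n (entry τ)) :
    ∃ (r : ℕ) (σ : Equiv.Perm (Fin (a + r + 1))) (α : Equiv.Perm (Fin (n - a - r))),
      b + r ≤ n ∧ Block n a (n - a - r) (entry τ) (entry σ) (entry α) ∧
      Parts a (a + r + 1) (b - a) (n - a - r) (entry σ) (entry α) ∧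
      Avoid2413 (a + r + 1) (entry σ) ∧ Avoid2413 (n - a - r) (entry α) := by
  have hw := wInj_entry τ
  have hab := h.lt
  obtain ⟨e, hbe, hen, hint, hmax⟩ := h.exists_maximal_isInterval hw H
  -- With `r = n - e` the lengths agree with those of a merge.
  obtain ⟨r, hr, her⟩ : ∃ r, r ≤ n - b ∧ e = a + (n - a - r) := ⟨n - e, by omega, by omega⟩
  subst her
  have hbn := h.le
  have hlen : n - (n - a - r) + 1 = a + r + 1 := by omega
  have h₁ := isSubword_std (m := a + r + 1) hw
    (f := fun i => if i ≤ a then i else if i = a + 1 then b else i + (n - a - r) - 1)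
    (by grind) (by grind) (by grind)
  have h₂ := isSubword_std (m := n - a - r) hw (f := fun i => i + a)
    (by grind) (by grind) (by grind)
  have hp := h.block_parts hw hs hbe hen hint hmax (hlen ▸ h₁) h₂
  rw [hlen] at hp
  exact ⟨r, _, _, by omega, h.block hbe hen hint (hlen ▸ h₁) h₂, hp,
    h₁.avoid2413 H, h₂.avoid2413 H⟩

end Induction

/-! ### The induction on the length. -/

section Induction

variable {n : ℕ}

theorem theta_spec_of_lt_two (hn : n < 2) : ThetaSpec n := by
  have hid : ∀ π, Theta n π = π := fun π => by rw [Theta, dif_pos (by omega)]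
  have h1 : ∀ w, Avoid1423 n w := fun w i j k l _ _ _ _ _ => by omega
  have h2 : ∀ w, Avoid2413 n w := fun w i j k l _ _ _ _ _ => by omega
  refine ⟨fun π _ => h2 _, fun π _ => ?_, fun π τ _ _ h => ?_, fun τ _ => ⟨τ, h1 _, hid τ⟩,
    fun π _ _ => hid π⟩
  · rw [hid]
    exact ⟨fun _ => Iff.rfl, fun _ => Iff.rfl, fun _ => Iff.rfl, fun _ => Iff.rfl, fun _ => Iff.rfl⟩
  · rwa [hid, hid] at h

theorem theta_sameStat (ih : ∀ m < n, ThetaSpec m) (hn : 2 ≤ n) (π : Equiv.Perm (Fin n))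
    (H : Avoid1423 n (entry π)) : SameStat n (entry π) (entry (Theta n π)) := by
  rcases theta_cases π with ⟨k, hk⟩ | ⟨hs, h | ⟨a, b, h⟩⟩
  · obtain ⟨s1, s2⟩ := splitAt_theta hk
    have hk1 := hk.1.1
    have hkn := hk.1.2.1
    exact s1.sameStat s2 hk1 hkn
      ((ih (n - 1) (by omega)).stat _ ((s1.avoid1423_iff hk1 hkn).1 H))
  · obtain ⟨s1, s2⟩ := insertTop_theta hn hs h
    have hb := phiB_spec π
    have hbn := phiB_le π (by omega)
    exact s1.sameStat s2 hb.1 hbn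
      ((ih (n - 1) (by omega)).stat _ ((s1.avoid1423_iff hb.1 hbn hb.2).1 H))
  · obtain ⟨r, σ, α, hbr, hm, hp, h1, h2, -, hB⟩ := h.exists_merge hs H
    have hab := h.lt
    have hpos := h.one_le
    exact hm.sameStat hB hab hbr hp (wInj_entry _) ((ih _ (by omega)).stat σ h1)
      ((ih _ (by omega)).stat α h2)

theorem theta_avoid (ih : ∀ m < n, ThetaSpec m) (hn : 2 ≤ n) (π : Equiv.Perm (Fin n))
    (H : Avoid1423 n (entry π)) : Avoid2413 n (entry (Theta n π)) := by
  have hst := theta_sameStat ih hn π H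
  rcases theta_cases π with ⟨k, hk⟩ | ⟨hs, h | ⟨a, b, h⟩⟩
  · obtain ⟨s1, s2⟩ := splitAt_theta hk
    have hk1 := hk.1.1
    have hkn := hk.1.2.1
    exact (s2.avoid2413_iff hk1 hkn).2
      ((ih (n - 1) (by omega)).avoid _ ((s1.avoid1423_iff hk1 hkn).1 H))
  · obtain ⟨s1, s2⟩ := insertTop_theta hn hs h
    have hb := phiB_spec π
    have hbn := phiB_le π (by omega)
    exact (s2.avoid2413_iff hb.1 hbn fun i hi hin => (hst.rl i).1 (hb.2 i hi hin)).2
      ((ih (n - 1) (by omega)).avoid _ ((s1.avoid1423_iff hb.1 hbn hb.2).1 H))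
  · obtain ⟨r, σ, α, hbr, hm, hp, h1, h2, -, hB⟩ := h.exists_merge hs H
    have hab := h.lt
    have hpos := h.one_le
    refine hB.avoid2413 (by omega) ?_ ((ih _ (by omega)).avoid α h2)
    rw [show n - (n - a - r) + 1 = a + r + 1 by omega]
    exact (ih _ (by omega)).avoid σ h1

/-- Equal images have equal statistics, so both arguments fall into the same case with the same `k`,
or `b`, or `a` and `b`. The ingredients of the image are unique, once the block length is fixed by
`Block.length_le`. -/
theorem theta_inj (ih : ∀ m < n, ThetaSpec m) (hn : 2 ≤ n) (π τ : Equiv.Perm (Fin n))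
    (H : Avoid1423 n (entry π)) (H' : Avoid1423 n (entry τ)) (he : Theta n π = Theta n τ) :
    π = τ := by
  have hst : SameStat n (entry π) (entry τ) :=
    (theta_sameStat ih hn π H).trans (he ▸ (theta_sameStat ih hn τ H').symm)
  rcases theta_cases π with ⟨k, hk⟩ | ⟨hs, h | ⟨a, b, h⟩⟩
  · obtain ⟨s1, s2⟩ := splitAt_theta hk
    obtain ⟨t1, t2⟩ := splitAt_theta (hst.isMinStep hk)
    have hk1 := hk.1.1
    have hkn := hk.1.2.1
    have heq := (ih (n - 1) (by omega)).inj _ _ ((s1.avoid1423_iff hk1 hkn).1 H)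
      ((t1.avoid1423_iff hk1 hkn).1 H') (s2.unique (he ▸ t2) hk1 hkn)
    exact s1.ext (heq ▸ t1)
  · obtain ⟨s1, s2⟩ := insertTop_theta hn hs h
    obtain ⟨t1, t2⟩ := insertTop_theta (π := τ) hn (fun i hi => hs i ((hst.step i).2 hi))
      (hst.phiA_eq ▸ h)
    have hb := phiB_spec π
    have hb' := phiB_spec τ
    have hbn := phiB_le π (by omega)
    rw [← hst.phiB_eq] at t1 t2 hb'
    have heq := (ih (n - 1) (by omega)).inj _ _ ((s1.avoid1423_iff hb.1 hbn hb.2).1 H)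
      ((t1.avoid1423_iff hb.1 hbn hb'.2).1 H') (s2.unique (he ▸ t2))
    exact s1.ext (heq ▸ t1)
  · obtain ⟨r, σ, α, hbr, hm, hp, h1, h2, -, hB⟩ := h.exists_merge hs H
    obtain ⟨r', σ', α', hbr', hm', hp', h1', h2', -, hB'⟩ :=
      (hst.shape h).exists_merge (fun i hi => hs i ((hst.step i).2 hi)) H'
    have hab := h.lt
    have hpos := h.one_le
    rw [← he] at hB'
    have hq := hp.of_sameStat ((ih _ (by omega)).stat σ h1) ((ih _ (by omega)).stat α h2)
    have hq' := hp'.of_sameStat ((ih _ (by omega)).stat σ' h1') ((ih _ (by omega)).stat α' h2')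
    have l1 := hB.length_le hB' hab (by omega) (by omega) (by omega) (by omega) (by omega) hq
    have l2 := hB'.length_le hB hab (by omega) (by omega) (by omega) (by omega) (by omega) hq'
    obtain rfl : r = r' := by omega
    have e1 := (ih _ (by omega)).inj σ σ' h1 h1'
      (hB.unique_left hB' (by omega) (by omega) (by omega))
    have e2 := (ih _ (by omega)).inj α α' h2 h2' (hB.unique_right hB' (by omega))
    subst e1 e2
    exact hm.ext hm'

/-- Decompose `τ`, pull its parts back by induction and reassemble them on the 1423 side. `Theta`
takes the result apart in the same way, because the parameters it reads off are preserved. -/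
theorem theta_surj (ih : ∀ m < n, ThetaSpec m) (hn : 2 ≤ n) (τ : Equiv.Perm (Fin n))
    (H : Avoid2413 n (entry τ)) : ∃ π, Avoid1423 n (entry π) ∧ Theta n π = τ := by
  rcases theta_cases τ with ⟨k, hk⟩ | ⟨hs, h | ⟨a, b, h⟩⟩
  · have hk1 := hk.1.1
    have hkn := hk.1.2.1
    have t := splitAt_deleteAt hk.1
    obtain ⟨ρ, hρ, hρe⟩ := (ih (n - 1) (by omega)).surj _ ((t.avoid2413_iff hk1 hkn).1 H)
    have s := splitAt_inflate hk1 hkn ρ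
    refine ⟨_, (s.avoid1423_iff hk1 hkn).2 hρ, ?_⟩
    have hst := s.sameStat t hk1 hkn (hρe ▸ (ih (n - 1) (by omega)).stat ρ hρ)
    obtain ⟨s1, s2⟩ := splitAt_theta (hst.symm.isMinStep hk)
    rw [s1.unique s hk1 hkn, hρe] at s2
    exact s2.ext t
  · have hb := phiB_spec τ
    have hbn := phiB_le τ (by omega)
    have t := insertTop_deleteAt (isTop_phiB (by omega) h)
    obtain ⟨ρ, hρ, hρe⟩ := (ih (n - 1) (by omega)).surj _ ((t.avoid2413_iff hb.1 hbn hb.2).1 H)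
    have s := insertTop_insertMax hb.1 hbn ρ
    have hst := s.sameStat t hb.1 hbn (hρe ▸ (ih (n - 1) (by omega)).stat ρ hρ)
    refine ⟨_, (s.avoid1423_iff hb.1 hbn fun i hi hin => (hst.rl i).2 (hb.2 i hi hin)).2 hρ, ?_⟩
    obtain ⟨s1, s2⟩ := insertTop_theta hn (fun i hi => hs i ((hst.step i).1 hi))
      (hst.phiA_eq.trans h)
    rw [hst.phiB_eq] at s1 s2
    rw [s1.unique s, hρe] at s2
    exact s2.ext t
  · have hab := h.lt
    have hpos := h.one_le
    obtain ⟨r, σ, α, hbr, hB, hp, h1, h2⟩ := h.exists_block hs H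
    obtain ⟨σ', g1, rfl⟩ := (ih _ (by omega)).surj σ h1
    obtain ⟨α', g2, rfl⟩ := (ih _ (by omega)).surj α h2
    have hq := hp.of_sameStat ((ih _ (by omega)).stat σ' g1).symm
      ((ih _ (by omega)).stat α' g2).symm
    obtain ⟨π, hm⟩ := exists_perm_merge hab hbr σ' α'
    refine ⟨π, hm.avoid1423 hab hbr hq g1 g2, ?_⟩
    rw [(hm.shape hab hbr hq).theta_eq (hm.not_isStep hab hbr hq) hbr
      (fun i hi hin => hm.mid_lt_iff hab hbr hq i hi hin) rfl rfl (hm.isSubword_left hab hbr)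
      (hm.isSubword_right hab hbr hq (wInj_entry _))]
    exact (block_inflate _ _ (by omega) (by omega) (by omega)).ext hB

theorem theta_fixed (ih : ∀ m < n, ThetaSpec m) (hn : 2 ≤ n) (π : Equiv.Perm (Fin n))
    (H : Avoid1423 n (entry π)) (H' : Avoid2413 n (entry π)) : Theta n π = π := by
  rcases theta_cases π with ⟨k, hk⟩ | ⟨hs, h | ⟨a, b, h⟩⟩
  · obtain ⟨s1, s2⟩ := splitAt_theta hk
    have hk1 := hk.1.1
    have hkn := hk.1.2.1
    rw [(ih (n - 1) (by omega)).fixed _ ((s1.avoid1423_iff hk1 hkn).1 H)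
      ((s1.avoid2413_iff hk1 hkn).1 H')] at s2
    exact s2.ext s1
  · obtain ⟨s1, s2⟩ := insertTop_theta hn hs h
    have hb := phiB_spec π
    have hbn := phiB_le π (by omega)
    rw [(ih (n - 1) (by omega)).fixed _ ((s1.avoid1423_iff hb.1 hbn hb.2).1 H)
      ((s1.avoid2413_iff hb.1 hbn hb.2).1 H')] at s2
    exact s2.ext s1
  · obtain ⟨r, σ, α, hbr, hm, hp, h1, h2, h3, hB⟩ := h.exists_merge hs H
    have hab := h.lt
    have hpos := h.one_le
    rw [(ih _ (by omega)).fixed σ h1 (h3 H').1, (ih _ (by omega)).fixed α h2 (h3 H').2] at hB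
    exact hB.ext (h.merge_eq_block (wInj_entry π) H' hs hm hbr hp (wInj_entry _))

theorem theta_spec (n : ℕ) : ThetaSpec n := by
  induction n using Nat.strong_induction_on with
  | _ n ih =>
    rcases Nat.lt_or_ge n 2 with hn | hn
    · exact theta_spec_of_lt_two hn
    · exact ⟨theta_avoid ih hn, theta_sameStat ih hn, theta_inj ih hn, theta_surj ih hn,
        theta_fixed ih hn⟩

end Induction

/-! ### Transfer to `Omega` by reverse-complement. -/

section ReverseComplement

variable {n : ℕ}

theorem complement_reverse (π : Equiv.Perm (Fin n)) :
    complement (reverse π) = reverse (complement π) := rfl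

theorem reverse_complement_self (π : Equiv.Perm (Fin n)) :
    reverse (complement (reverse (complement π))) = π := by
  ext i
  simp [reverse, complement]

theorem entry_reverse_complement (π : Equiv.Perm (Fin n)) (i : ℕ) (hi : 1 ≤ i) (hin : i ≤ n) :
    entry (reverse (complement π)) i = n + 1 - entry π (n + 1 - i) := by
  have h : Fin.rev (⟨i - 1, by omega⟩ : Fin n) = ⟨n + 1 - i - 1, by omega⟩ := by
    ext
    simp only [Fin.val_rev]
    omega
  rw [entry_eq _ i hi hin, entry_eq _ (n + 1 - i) (by omega) (by omega)]
  simp only [reverse, complement, Equiv.trans_apply, Fin.revPerm_apply, h, Fin.val_rev]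
  omega

theorem entry_reverse_complement_lt (π : Equiv.Perm (Fin n)) (i j : ℕ) (hi : 1 ≤ i) (hin : i ≤ n)
    (hj : 1 ≤ j) (hjn : j ≤ n) :
    entry (reverse (complement π)) i < entry (reverse (complement π)) j ↔
      entry π (n + 1 - j) < entry π (n + 1 - i) := by
  rw [entry_reverse_complement π i hi hin, entry_reverse_complement π j hj hjn]
  have h1 := entry_le π (n + 1 - i)
  have h2 := entry_le π (n + 1 - j)
  omega

theorem mem_avoiders_2314 {π : Equiv.Perm (Fin n)} : π ∈ avoiders n ![2, 3, 1, 4] ↔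
    ∀ i j k l, 1 ≤ i → i < j → j < k → k < l → l ≤ n →
      ¬ (entry π k < entry π i ∧ entry π i < entry π j ∧ entry π j < entry π l) := by
  simp only [avoiders, Set.mem_ofPred_eq, contains_iff]
  constructor
  · rintro H i j k l h1 h2 h3 h4 h5 ⟨h6, h7, h8⟩
    refine H ⟨i, j, k, l, h1, h2, h3, h4, h5, fun x y => ?_⟩
    fin_cases x <;> fin_cases y <;> simp <;> omega
  · rintro H ⟨i, j, k, l, h1, h2, h3, h4, h5, h⟩
    exact H i j k l h1 h2 h3 h4 h5 ⟨(h 2 0).2 (by decide), (h 0 1).2 (by decide),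
      (h 1 3).2 (by decide)⟩

theorem reverse_complement_mem_1423 (π : Equiv.Perm (Fin n)) :
    reverse (complement π) ∈ avoiders n ![1, 4, 2, 3] ↔ π ∈ avoiders n ![2, 3, 1, 4] := by
  rw [mem_avoiders_1423, mem_avoiders_2314]
  constructor
  · intro H i j k l h1 h2 h3 h4 h5 h6
    refine H (n + 1 - l) (n + 1 - k) (n + 1 - j) (n + 1 - i) (by omega) (by omega) (by omega)
      (by omega) (by omega) ?_
    rw [entry_reverse_complement_lt, entry_reverse_complement_lt, entry_reverse_complement_lt,
      Nat.sub_sub_self, Nat.sub_sub_self, Nat.sub_sub_self, Nat.sub_sub_self] <;> omega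
  · intro H i j k l h1 h2 h3 h4 h5
    rw [entry_reverse_complement_lt, entry_reverse_complement_lt, entry_reverse_complement_lt]
    · have := H (n + 1 - l) (n + 1 - k) (n + 1 - j) (n + 1 - i)
      omega
    all_goals omega

theorem reverse_complement_mem_2413 (π : Equiv.Perm (Fin n)) :
    reverse (complement π) ∈ avoiders n ![2, 4, 1, 3] ↔ π ∈ avoiders n ![2, 4, 1, 3] := by
  have key : ∀ π : Equiv.Perm (Fin n), π ∈ avoiders n ![2, 4, 1, 3] →
      reverse (complement π) ∈ avoiders n ![2, 4, 1, 3] := by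
    intro π
    rw [mem_avoiders_2413, mem_avoiders_2413]
    intro H i j k l h1 h2 h3 h4 h5
    rw [entry_reverse_complement_lt, entry_reverse_complement_lt, entry_reverse_complement_lt]
    · have := H (n + 1 - l) (n + 1 - k) (n + 1 - j) (n + 1 - i)
      omega
    all_goals omega
  refine ⟨fun h => ?_, key π⟩
  have := key _ h
  rwa [reverse_complement_self] at this

theorem mem_descents_iff_reverse_complement (π : Equiv.Perm (Fin n)) (i : ℕ) :
    i ∈ descents π ↔ i < n ∧ IsDesc n (entry (reverse (complement π))) (n - i) := by
  have h1 : i < n → IsDesc n (entry (reverse (complement π))) (n - i) → 1 ≤ i := fun _ h => by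
    have := h.2.1
    omega
  rw [mem_descents]
  by_cases hi : 1 ≤ i ∧ i < n
  · rw [IsDesc, IsDesc,
      entry_reverse_complement_lt _ _ _ (by omega) (by omega) (by omega) (by omega),
      show n + 1 - (n - i) = i + 1 by omega, show n + 1 - (n - i + 1) = i by omega]
    omega
  · exact iff_of_false (fun h => hi ⟨h.1, h.2.1⟩) (fun h => hi ⟨h1 h.1 h.2, h.1⟩)

theorem mem_steps_iff_reverse_complement (π : Equiv.Perm (Fin n)) (i : ℕ) :
    i ∈ steps π ↔ i < n ∧ IsStep n (entry (reverse (complement π))) (n - i) := by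
  rw [← mem_steps]
  simp only [steps, mem_filter, mem_Ico]
  by_cases hi : 1 ≤ i ∧ i < n
  · rw [entry_reverse_complement _ _ (by omega) (by omega),
      entry_reverse_complement _ _ (by omega) (by omega),
      show n + 1 - (n - i) = i + 1 by omega, show n + 1 - (n - i + 1) = i by omega]
    have h1 := entry_le π i
    have h2 := entry_le π (i + 1)
    omega
  · omega

theorem mem_lrMin_iff_reverse_complement (π : Equiv.Perm (Fin n)) (i : ℕ) :
    i ∈ lrMin π ↔ i ≤ n ∧ IsRL n (entry (reverse (complement π))) (n + 1 - i) := by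
  simp only [lrMin, mem_filter, mem_Icc, mem_Ico, IsRL]
  constructor
  · rintro ⟨⟨h1, h2⟩, h3⟩
    refine ⟨h2, by omega, by omega, fun j hj hjn => ?_⟩
    rw [entry_reverse_complement_lt _ _ _ (by omega) (by omega) (by omega) (by omega),
      Nat.sub_sub_self (by omega)]
    exact h3 _ ⟨by omega, by omega⟩
  · rintro ⟨h1, h2, h3, h4⟩
    refine ⟨⟨by omega, h1⟩, fun j hj => ?_⟩
    have := h4 (n + 1 - j) (by omega) (by omega)
    rwa [entry_reverse_complement_lt _ _ _ (by omega) (by omega) (by omega) (by omega),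
      Nat.sub_sub_self (by omega), Nat.sub_sub_self (by omega)] at this

theorem position_one_eq_of_isTop {π τ : Equiv.Perm (Fin n)}
    (h : ∀ i, IsTop n (entry (reverse (complement π))) i ↔
      IsTop n (entry (reverse (complement τ))) i) : position π 1 = position τ 1 := by
  rcases Nat.eq_zero_or_pos n with rfl | hn
  · rw [Subsingleton.elim π τ]
  obtain ⟨i, hi, hin, hie⟩ := exists_entry_eq τ 1 le_rfl hn
  rw [(position_eq_iff 1 i le_rfl hn hi hin).2 hie, position_eq_iff 1 i le_rfl hn hi hin]
  have := h (n + 1 - i)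
  rw [isTop_iff_entry _ (by omega) (by omega), isTop_iff_entry _ (by omega) (by omega),
    entry_reverse_complement _ _ (by omega) (by omega),
    entry_reverse_complement _ _ (by omega) (by omega), Nat.sub_sub_self (by omega)] at this
  have := entry_le π i
  omega

theorem position_two_eq_of_isSecond {π τ : Equiv.Perm (Fin n)}
    (h : ∀ i, IsSecond n (entry (reverse (complement π))) i ↔
      IsSecond n (entry (reverse (complement τ))) i) : position π 2 = position τ 2 := by
  rcases Nat.lt_or_ge n 2 with hn | hn
  -- The value 2 does not occur, and both positions are the default 0.
  · rw [position, position, entry, entry, dif_neg (by omega), dif_neg (by omega)]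
  obtain ⟨i, hi, hin, hie⟩ := exists_entry_eq τ 2 (by omega) hn
  rw [(position_eq_iff 2 i (by omega) hn hi hin).2 hie, position_eq_iff 2 i (by omega) hn hi hin]
  have := h (n + 1 - i)
  rw [isSecond_iff_entry _ hn (by omega) (by omega), isSecond_iff_entry _ hn (by omega) (by omega),
    entry_reverse_complement _ _ (by omega) (by omega),
    entry_reverse_complement _ _ (by omega) (by omega), Nat.sub_sub_self (by omega)] at this
  have := entry_le π i
  omega

theorem bijOn_Theta (n : ℕ) :
    Set.BijOn (Theta n) (avoiders n ![1, 4, 2, 3]) (avoiders n ![2, 4, 1, 3]) := by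
  have h := theta_spec n
  refine ⟨fun π hπ => mem_avoiders_2413.2 (h.avoid π (mem_avoiders_1423.1 hπ)),
    fun π hπ τ hτ he => h.inj π τ (mem_avoiders_1423.1 hπ) (mem_avoiders_1423.1 hτ) he,
    fun τ hτ => ?_⟩
  obtain ⟨π, hπ, he⟩ := h.surj τ (mem_avoiders_2413.1 hτ)
  exact ⟨π, mem_avoiders_1423.2 hπ, he⟩

theorem reverse_complement_Omega (π : Equiv.Perm (Fin n)) :
    reverse (complement (Omega n π)) = Theta n (reverse (complement π)) := by
  rw [Omega, complement_reverse, reverse_complement_self]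

theorem bijOn_Omega (n : ℕ) :
    Set.BijOn (Omega n) (avoiders n ![2, 3, 1, 4]) (avoiders n ![2, 4, 1, 3]) := by
  refine ⟨fun π hπ => ?_, fun π hπ τ hτ he => ?_, fun τ hτ => ?_⟩
  · rw [← reverse_complement_mem_2413, reverse_complement_Omega]
    exact (bijOn_Theta n).mapsTo ((reverse_complement_mem_1423 π).2 hπ)
  · have := (bijOn_Theta n).injOn ((reverse_complement_mem_1423 π).2 hπ)
      ((reverse_complement_mem_1423 τ).2 hτ)
      (by rw [← reverse_complement_Omega, ← reverse_complement_Omega, he])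
    rw [← reverse_complement_self π, this, reverse_complement_self]
  · obtain ⟨ρ, hρ, hρe⟩ := (bijOn_Theta n).surjOn ((reverse_complement_mem_2413 τ).2 hτ)
    refine ⟨reverse (complement ρ), ?_, ?_⟩
    · rwa [← reverse_complement_mem_1423, reverse_complement_self]
    · rw [Omega, reverse_complement_self, hρe, complement_reverse, reverse_complement_self]

theorem sameStat_Omega {π : Equiv.Perm (Fin n)} (hπ : π ∈ avoiders n ![2, 3, 1, 4]) :
    SameStat n (entry (reverse (complement (Omega n π)))) (entry (reverse (complement π))) := by
  rw [reverse_complement_Omega]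
  exact ((theta_spec n).stat _ (mem_avoiders_1423.1 ((reverse_complement_mem_1423 π).2 hπ))).symm

theorem descents_Omega {π : Equiv.Perm (Fin n)} (hπ : π ∈ avoiders n ![2, 3, 1, 4]) :
    descents (Omega n π) = descents π := by
  ext i
  rw [mem_descents_iff_reverse_complement, mem_descents_iff_reverse_complement,
    (sameStat_Omega hπ).desc]

theorem majCount_eq_of_bijOn {m : ℕ} {τ τ' : Fin m → ℕ}
    {f : Equiv.Perm (Fin n) → Equiv.Perm (Fin n)}
    (hf : Set.BijOn f (avoiders n τ) (avoiders n τ'))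
    (hd : ∀ π ∈ avoiders n τ, descents (f π) = descents π) (k : ℕ) :
    majCount n τ k = majCount n τ' k := by
  have hmaj : ∀ π ∈ avoiders n τ, maj (f π) = maj π := fun π hπ => by rw [maj, maj, hd π hπ]
  have himg : f '' {π ∈ avoiders n τ | maj π = k} = {π ∈ avoiders n τ' | maj π = k} := by
    ext ρ
    constructor
    · rintro ⟨π, ⟨hπ, hk⟩, rfl⟩
      exact ⟨hf.mapsTo hπ, (hmaj π hπ).trans hk⟩
    · rintro ⟨hρ, hk⟩
      obtain ⟨π, hπ, rfl⟩ := hf.surjOn hρ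
      exact ⟨π, ⟨hπ, (hmaj π hπ).symm.trans hk⟩, rfl⟩
  rw [majCount, majCount, ← himg]
  exact ((hf.injOn.mono fun π hπ => hπ.1).ncard_image).symm

end ReverseComplement

end PermStat

theorem corollary2 (n : ℕ) :
    Set.BijOn (PermStat.Omega n)
      (PermStat.avoiders n ![2, 3, 1, 4]) (PermStat.avoiders n ![2, 4, 1, 3]) ∧
    (∀ π ∈ PermStat.avoiders n ![2, 3, 1, 4],
      PermStat.descents (PermStat.Omega n π) = PermStat.descents π ∧
      PermStat.lrMin (PermStat.Omega n π) = PermStat.lrMin π ∧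
      PermStat.steps (PermStat.Omega n π) = PermStat.steps π ∧
      PermStat.position (PermStat.Omega n π) 1 = PermStat.position π 1 ∧
      PermStat.position (PermStat.Omega n π) 2 = PermStat.position π 2) ∧
    (∀ π ∈ PermStat.avoiders n ![2, 3, 1, 4] ∩ PermStat.avoiders n ![2, 4, 1, 3],
      PermStat.Omega n π = π) ∧
    (∀ k : ℕ,
      PermStat.majCount n ![1, 4, 2, 3] k = PermStat.majCount n ![2, 4, 1, 3] k ∧
      PermStat.majCount n ![2, 3, 1, 4] k = PermStat.majCount n ![2, 4, 1, 3] k) := by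
  open PermStat in
  refine ⟨bijOn_Omega n, fun π hπ => ?_, fun π hπ => ?_, fun k => ⟨?_, ?_⟩⟩
  · have h := sameStat_Omega hπ
    refine ⟨descents_Omega hπ, ?_, ?_, position_one_eq_of_isTop h.top,
      position_two_eq_of_isSecond h.second⟩
    · ext i
      rw [mem_lrMin_iff_reverse_complement, mem_lrMin_iff_reverse_complement, h.rl]
    · ext i
      rw [mem_steps_iff_reverse_complement, mem_steps_iff_reverse_complement, h.step]
  · rw [Omega, (theta_spec n).fixed _
      (mem_avoiders_1423.1 ((reverse_complement_mem_1423 π).2 hπ.1))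
      (mem_avoiders_2413.1 ((reverse_complement_mem_2413 π).2 hπ.2)),
      complement_reverse, reverse_complement_self]
  · refine majCount_eq_of_bijOn (bijOn_Theta n) (fun π hπ => ?_) k
    ext i
    rw [mem_descents, mem_descents, ((theta_spec n).stat π (mem_avoiders_1423.1 hπ)).desc]
  · exact majCount_eq_of_bijOn (bijOn_Omega n) (fun π hπ => descents_Omega hπ) k
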